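/- Let $d\ge 1$ and $n\ge d+3$, let $V=\{v_1,\dots,v_n\}$, and call $v_1,\dots,v_d$ the poles. For a cycle $C$ with vertex set $\{v_{d+1},\dots,v_n\}$ put $f_{xy}=\{v_1,\dots,v_d,x,y\}$ for $xy\in E(C)$, let $B(C)$ be the simplicial complex consisting of all nonempty subsets of the sets $f_{xy}$, $xy\in E(C)$, and let $S_C=\partial B(C)$ be its boundary, i.e. the complex generated by the codimension-one faces of $B(C)$ that lie in exactly one facet. A simplicial $d$-sphere (simplicial $D$-ball) is a finite simplicial complex whose geometric realization is homeomorphic to the unit sphere $\mathbb S^d$ (to the closed unit ball of $\mathbb R^D$). A simplicial $D$-ball is locally constructible (LC) if it can be built from a single $D$-simplex by a sequence of the following two moves: (1) glue a new $D$-simplex, along one of its $(D-1)$-faces, to a $(D-1)$-simplex on the boundary; (2) glue together two $(D-1)$-simplices on the boundary that already overlap in a $(D-2)$-simplex, by the map that fixes this $(D-2)$-simplex; here the intermediate objects are regular cell complexes all of whose cells are simplices. A simplicial $d$-sphere is locally constructible if it is the boundary of a locally constructible $(d+1)$-ball. Then, for every such cycle $C$: (a) $B(C)=\mathrm{Cone}_{v_1}(\mathrm{Cone}_{v_2}(\cdots\mathrm{Cone}_{v_d}(C)\cdots))$,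 where $\mathrm{Cone}_z(K)$ adds to $K$ the vertex $z$ and the simplex $s\cup\{z\}$ for every $s\in K$; thus $S_C=\partial(\mathrm{Cone}^d C)$; (b) $S_C$ is a locally constructible simplicial $d$-sphere; (c) the facets of $S_C$ are exactly the sets $f_{xy}\setminus\{v_i\}$ with $xy\in E(C)$ and $1\le i\le d$, and there are $d(n-d)$ of them. In particular, let $S^*_{n,d}$ be the complex whose facets are the $(d+1)$-subsets of $V$ whose intersection with $\{v_1,\dots,v_{n-d}\}$ is one of $\{v_1,v_2\},\dots,\{v_{n-d-1},v_{n-d}\},\{v_{n-d},v_1\}$. For the cycle $C=v_{d+1}v_{d+2}\cdots v_nv_{d+1}$, the cyclic relabelling $v_{d+j}\mapsto v_j$ ($1\le j\le n-d$), $v_i\mapsto v_{n-d+i}$ ($1\le i\le d$) carries $S_C$ onto $S^*_{n,d}$, and $S^*_{n,d}$ is a locally constructible simplicial $d$-sphere. -/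

import Mathlib

namespace LCSphere

/-! ### Simplicial complexes -/

section Complexes

variable {V : Type} [DecidableEq V]

/-- The simplicial complex generated by a family of finite sets: all their nonempty subsets. -/
def closure (F : Set (Finset V)) : PreAbstractSimplicialComplex V where
  faces := {s | s.Nonempty ∧ ∃ t ∈ F, s ⊆ t}
  isRelLowerSet_faces := by
    rintro s ⟨hs, t, ht, hst⟩
    exact ⟨hs, fun u hu hne => ⟨hne, t, ht, hu.trans hst⟩⟩

/-- The facets of a complex are its inclusion-maximal faces. -/
def facets (K : PreAbstractSimplicialComplex V) : Set (Finset V) :=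
  {s | Maximal (· ∈ K.faces) s}

/-- The boundary of a (pure) complex: the complex generated by those codimension-one faces that
lie in exactly one facet. -/
def boundary (K : PreAbstractSimplicialComplex V) : PreAbstractSimplicialComplex V :=
  closure {s | ∃ t ∈ facets K, s ⊆ t ∧ s.card + 1 = t.card ∧ ∀ t' ∈ facets K, s ⊆ t' → t' = t}

/-- The cone with apex `z`: add the vertex `z` and the simplex `s ∪ {z}` for every `s ∈ K`. -/
def cone (z : V) (K : PreAbstractSimplicialComplex V) : PreAbstractSimplicialComplex V where
  faces := K.faces ∪ {s | ∃ t, (t = ∅ ∨ t ∈ K.faces) ∧ s = insert z t}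
  isRelLowerSet_faces := by
    have key : ∀ t : Finset V, (t = ∅ ∨ t ∈ K.faces) → ∀ u ⊆ t, u = ∅ ∨ u ∈ K.faces := by
      intro t ht u hu
      rcases u.eq_empty_or_nonempty with h | h
      · exact Or.inl h
      · rcases ht with rfl | ht
        · exact Or.inl (Finset.subset_empty.mp hu)
        · exact Or.inr ((K.isRelLowerSet_faces ht).2 hu h)
    rintro s (hs | ⟨t, ht, rfl⟩)
    · exact ⟨(K.isRelLowerSet_faces hs).1,
        fun u hu hne => Or.inl ((K.isRelLowerSet_faces hs).2 hu hne)⟩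
    · refine ⟨Finset.insert_nonempty _ _, fun u hu hne => ?_⟩
      have hu' : u.erase z ⊆ t := Finset.subset_insert_iff.mp hu
      by_cases hz : z ∈ u
      · exact Or.inr ⟨u.erase z, key t ht _ hu', (Finset.insert_erase hz).symm⟩
      · rw [Finset.erase_eq_of_notMem hz] at hu'
        rcases key t ht u hu' with h | h
        · exact absurd h hne.ne_empty
        · exact Or.inl h

/-- The geometric realization of a complex on a finite vertex set, in barycentric coordinates. -/
def realization [Fintype V] (K : PreAbstractSimplicialComplex V) : Set (V → ℝ) :=
  {x | x ∈ stdSimplex ℝ V ∧ Finset.univ.filter (fun v => x v ≠ 0) ∈ K.faces}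

/-- A simplicial `d`-sphere is a complex homeomorphic to the unit sphere of `ℝ^(d+1)`. -/
def IsSimplicialSphere [Fintype V] (d : ℕ) (K : PreAbstractSimplicialComplex V) : Prop :=
  Nonempty (realization K ≃ₜ Metric.sphere (0 : EuclideanSpace ℝ (Fin (d + 1))) 1)

/-- A simplicial `D`-ball is a complex homeomorphic to the closed unit ball of `ℝ^D`. -/
def IsSimplicialBall [Fintype V] (D : ℕ) (K : PreAbstractSimplicialComplex V) : Prop :=
  Nonempty (realization K ≃ₜ Metric.closedBall (0 : EuclideanSpace ℝ (Fin D)) 1)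

end Complexes

/-! ### Local constructions

The intermediate stages of a local construction are regular cell complexes all of whose cells are
simplices; two cells may share all their vertices, so that such a complex need not be a simplicial
complex. It is given by its poset of (nonempty) cells, in which the cells below a given one form
the face poset of a simplex. -/

section LocalConstructions

/-- The poset of nonempty faces of a `D`-simplex. -/
abbrev SimplexPoset (D : ℕ) : Type := {s : Finset (Fin (D + 1)) // s.Nonempty}

/-- A codimension-one cell on the boundary: a facet of exactly one maximal cell. -/
def IsBoundaryRidge {P : Type} [PartialOrder P] (σ : P) : Prop :=
  ∃ m : P, IsMax m ∧ σ ⋖ m ∧ ∀ m' : P, IsMax m' → σ ≤ m' → m' = m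

/-- `Q` arises from `P` by gluing a new `D`-simplex `m`, along one of its `(D-1)`-faces, to a
`(D-1)`-simplex `σ` on the boundary of `P`. -/
def GluesNewSimplex (D : ℕ) (P Q : Type) [PartialOrder P] [PartialOrder Q] : Prop :=
  ∃ (ι : P ↪o Q) (σ : P) (m : Q),
    IsBoundaryRidge σ ∧
    Nonempty (Set.Iic m ≃o SimplexPoset D) ∧
    IsLowerSet (Set.range ι) ∧
    Set.range ι ∪ Set.Iic m = Set.univ ∧
    Set.range ι ∩ Set.Iic m = Set.Iic (ι σ)

/-- `Q` arises from `P` by gluing together two codimension-one simplices `σ`, `τ` on the boundary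
of `P` that already overlap in a codimension-two simplex `ρ`. The gluing map `φ` fixes `ρ`, the
map `q` is the quotient map, and it keeps every cell of `P` a simplex (no two faces of one and
the same cell are identified). -/
def GluesBoundaryPair (P Q : Type) [PartialOrder P] [PartialOrder Q] : Prop :=
  ∃ (σ τ ρ : P) (φ : Set.Iic σ ≃o Set.Iic τ) (q : P → Q),
    σ ≠ τ ∧ IsBoundaryRidge σ ∧ IsBoundaryRidge τ ∧
    ρ ⋖ σ ∧ ρ ⋖ τ ∧
    (∀ x : Set.Iic σ, (x : P) ≤ ρ → (φ x : P) = x) ∧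
    Function.Surjective q ∧
    (∀ x y : P, q x = q y ↔
      x = y ∨ (∃ z : Set.Iic σ, (z : P) = x ∧ (φ z : P) = y) ∨
        (∃ z : Set.Iic σ, (z : P) = y ∧ (φ z : P) = x)) ∧
    (∀ x : P, ∃ e : Set.Iic x ≃o Set.Iic (q x), ∀ y : Set.Iic x, (e y : Q) = q y)

/-- The `D`-dimensional cell complexes that can be built from a single `D`-simplex by the two
gluing moves. -/
inductive LocallyConstructed (D : ℕ) : (P : Type) → [PartialOrder P] → Prop
  | simplex (P : Type) [PartialOrder P] (e : P ≃o SimplexPoset D) : LocallyConstructed D P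
  | glueNew (P Q : Type) [PartialOrder P] [PartialOrder Q] (hP : LocallyConstructed D P)
      (h : GluesNewSimplex D P Q) : LocallyConstructed D Q
  | gluePair (P Q : Type) [PartialOrder P] [PartialOrder Q] (hP : LocallyConstructed D P)
      (h : GluesBoundaryPair P Q) : LocallyConstructed D Q

variable {V : Type} [DecidableEq V] [Fintype V]

/-- A locally constructible `D`-ball: a simplicial `D`-ball whose face poset can be built by the
two gluing moves. -/
def IsLCBall (D : ℕ) (K : PreAbstractSimplicialComplex V) : Prop :=
  IsSimplicialBall D K ∧ LocallyConstructed D K.faces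

/-- A locally constructible `d`-sphere: a simplicial `d`-sphere that is (up to naming the vertices,
with additional interior vertices allowed) the boundary of a locally constructible
`(d+1)`-ball. -/
def IsLCSphere (d : ℕ) (S : PreAbstractSimplicialComplex V) : Prop :=
  IsSimplicialSphere d S ∧
    ∃ (m : ℕ) (f : V ↪ Fin m) (B : PreAbstractSimplicialComplex (Fin m)),
      IsLCBall (d + 1) B ∧ boundary B = S.map f

end LocalConstructions

/-! ### The spheres `S_C` and `S*_{n,d}`

The vertex `v_i` is the element `i - 1` of `Fin n`. -/

section Spheres

/-- The poles `v_1, …, v_d`. -/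
def poles (n d : ℕ) : Finset (Fin n) := Finset.univ.filter (fun i : Fin n => (i : ℕ) < d)

/-- The non-pole vertices `v_{d+1}, …, v_n`. -/
abbrev NonPole (n d : ℕ) : Type := {i : Fin n // d ≤ (i : ℕ)}

/-- `C` is a Hamilton cycle on the non-pole vertices. -/
def IsHamiltonCycle {n d : ℕ} (C : SimpleGraph (NonPole n d)) : Prop :=
  3 ≤ n - d ∧ Nonempty (C ≃g SimpleGraph.cycleGraph (n - d))

/-- The set `f_{xy} = {v_1, …, v_d, x, y}`. -/
def fSet {n d : ℕ} (x y : NonPole n d) : Finset (Fin n) := poles n d ∪ {x.1, y.1}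

/-- `B(C)`, the closure of the family of all `f_{xy}` with `xy ∈ E(C)`. -/
def ballOf {n d : ℕ} (C : SimpleGraph (NonPole n d)) : PreAbstractSimplicialComplex (Fin n) :=
  closure {s | ∃ x y : NonPole n d, C.Adj x y ∧ s = fSet x y}

/-- `S_C`, the boundary of `B(C)`. -/
def sphereOf {n d : ℕ} (C : SimpleGraph (NonPole n d)) : PreAbstractSimplicialComplex (Fin n) :=
  boundary (ballOf C)

/-- The graph `C` without isolated vertices as a one-dimensional complex. -/
def graphComplex {n d : ℕ} (C : SimpleGraph (NonPole n d)) :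
    PreAbstractSimplicialComplex (Fin n) :=
  closure {s | ∃ x y : NonPole n d, C.Adj x y ∧ s = {x.1, y.1}}

/-- The iterated cone `Cone_{v_1}(Cone_{v_2}(⋯ Cone_{v_d}(C) ⋯))`. -/
def iteratedCone {n d : ℕ} (C : SimpleGraph (NonPole n d)) :
    PreAbstractSimplicialComplex (Fin n) :=
  ((List.finRange n).filter (fun i : Fin n => (i : ℕ) < d)).foldr cone (graphComplex C)

/-- The cycle `v_{d+1} v_{d+2} ⋯ v_n v_{d+1}`. -/
def standardCycle (n d : ℕ) : SimpleGraph (NonPole n d) :=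
  SimpleGraph.fromRel fun x y => (y.1 : ℕ) - d = ((x.1 : ℕ) - d + 1) % (n - d)

/-- `S*_{n,d}`: its facets are the `(d+1)`-sets whose intersection with `{v_1, …, v_{n-d}}` is one
of `{v_1, v_2}, …, {v_{n-d-1}, v_{n-d}}, {v_{n-d}, v_1}`. -/
def starSphere (n d : ℕ) : PreAbstractSimplicialComplex (Fin n) :=
  closure {s | s.card = d + 1 ∧ ∃ i j : Fin n, (i : ℕ) < n - d ∧
    (j : ℕ) = ((i : ℕ) + 1) % (n - d) ∧
    s.filter (fun k : Fin n => (k : ℕ) < n - d) = {i, j}}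

end Spheres

end LCSphere

/-!
`B(C)` is the join of the simplex on the poles with the cycle `C`, and `S_C` is the join of the
boundary of that simplex with `C`.

Realization: place one vertex of a `(d - 1)`-simplex at the origin of `ℝ^(d-1)` and surround the
origin of `ℝ²` by a regular polygon. The convex hull of both in `ℝ^(d-1) × ℝ²` is a convex body
triangulated by the join of the simplex and the polygon, and the faces of its frontier are exactly
those missing a vertex of the simplex. Hence the pair `(B(C), S_C)` is a ball with its boundary
sphere.

Local constructibility: the join of the simplex with a path with `m` edges arises by gluing `m`
simplices one after the other. The cones over the two ends of the path are boundary ridges that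
overlap in the simplex on the poles, and one fold identifying them closes the path up to the cycle.
-/

namespace LCSphere

open Finset

/-! ### Complexes given by generators -/

section Complexes

variable {V W : Type}

theorem map_closure [DecidableEq W] (F : Set (Finset V)) (f : V → W) :
    (closure F).map f = closure (image f '' F) := by
  ext u
  constructor
  · rintro ⟨s, ⟨hs, t, ht, hst⟩, rfl⟩
    exact ⟨hs.image f, _, ⟨t, ht, rfl⟩, image_subset_image hst⟩
  · rintro ⟨hu, _, ⟨t, ht, rfl⟩, hut⟩
    obtain ⟨s, hs, rfl⟩ := subset_image_iff.mp hut
    exact ⟨s, ⟨image_nonempty.mp hu, t, ht, hs⟩, rfl⟩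

theorem map_map {X : Type} [DecidableEq W] [DecidableEq X] (K : PreAbstractSimplicialComplex V)
    (f : V → W) (g : W → X) : (K.map f).map g = K.map (g ∘ f) := by
  ext u
  simp [PreAbstractSimplicialComplex.map, image_image]

theorem facets_closure {F : Set (Finset V)} (hF : IsAntichain (· ⊆ ·) F) (hempty : ∅ ∉ F) :
    facets (closure F) = F := by
  have mem_closure : ∀ t ∈ F, t ∈ (closure F).faces := fun t ht =>
    ⟨nonempty_iff_ne_empty.mpr (ne_of_mem_of_not_mem ht hempty), t, ht, Subset.rfl⟩
  ext s
  constructor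
  · rintro ⟨⟨-, t, ht, hst⟩, hmax⟩
    exact hst.antisymm (hmax (mem_closure t ht) hst) ▸ ht
  · refine fun hs => ⟨mem_closure s hs, ?_⟩
    rintro t ⟨-, u, hu, htu⟩ hst
    exact hF.eq hs hu (hst.trans htu) ▸ htu

theorem facets_closure_of_sized {F : Set (Finset V)} {r : ℕ} (hF : F.Sized r) (hr : r ≠ 0) :
    facets (closure F) = F :=
  facets_closure hF.isAntichain fun h => hr (hF h).symm

theorem facets_map [DecidableEq W] (K : PreAbstractSimplicialComplex V) {f : V → W}
    (hf : f.Injective) : facets (K.map f) = image f '' facets K :=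
  (image_monotone_setOfPred_maximal_mem fun _ _ _ _ => image_subset_image_iff hf).symm

theorem boundary_map [DecidableEq W] (K : PreAbstractSimplicialComplex V) {f : V → W}
    (hf : f.Injective) : boundary (K.map f) = (boundary K).map f := by
  rw [boundary, boundary, map_closure, facets_map K hf]
  congr 1
  ext u
  constructor
  · rintro ⟨_, ⟨t, ht, rfl⟩, hut, hcard, huniq⟩
    obtain ⟨s, hst, rfl⟩ := subset_image_iff.mp hut
    rw [card_image_of_injective _ hf, card_image_of_injective _ hf] at hcard
    exact ⟨s, ⟨t, ht, hst, hcard, fun t' ht' hst' =>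
      image_injective hf (huniq _ ⟨t', ht', rfl⟩ (image_subset_image hst'))⟩, rfl⟩
  · rintro ⟨s, ⟨t, ht, hst, hcard, huniq⟩, rfl⟩
    refine ⟨_, ⟨t, ht, rfl⟩, image_subset_image hst, ?_, ?_⟩
    · rw [card_image_of_injective _ hf, card_image_of_injective _ hf, hcard]
    · rintro _ ⟨t', ht', rfl⟩ hst'
      rw [huniq t' ht' ((image_subset_image_iff hf).mp hst')]

variable [DecidableEq V]

theorem cone_closure {F : Set (Finset V)} (hF : F.Nonempty) (z : V) :
    cone z (closure F) = closure (insert z '' F) := by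
  ext u
  constructor
  · rintro (⟨hu, t, ht, hut⟩ | ⟨t, rfl | ⟨-, s, hs, hts⟩, rfl⟩)
    · exact ⟨hu, _, ⟨t, ht, rfl⟩, hut.trans (subset_insert _ _)⟩
    · obtain ⟨s, hs⟩ := hF
      exact ⟨insert_nonempty _ _, _, ⟨s, hs, rfl⟩, insert_subset_insert _ (empty_subset _)⟩
    · exact ⟨insert_nonempty _ _, _, ⟨s, hs, rfl⟩, insert_subset_insert _ hts⟩
  · rintro ⟨hu, _, ⟨t, ht, rfl⟩, hut⟩
    by_cases hz : z ∈ u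
    · refine Or.inr ⟨u.erase z, ?_, (insert_erase hz).symm⟩
      rcases (u.erase z).eq_empty_or_nonempty with h | h
      · exact Or.inl h
      · exact Or.inr ⟨h, t, ht, subset_insert_iff.mp hut⟩
    · exact Or.inl ⟨hu, t, ht, (subset_insert_iff_of_notMem hz).mp hut⟩

theorem foldr_cone_closure {F : Set (Finset V)} (hF : F.Nonempty) (L : List V) :
    L.foldr cone (closure F) = closure ((L.toFinset ∪ ·) '' F) := by
  induction L with
  | nil => simp
  | cons z L ih =>
    rw [List.foldr_cons, ih, cone_closure (hF.image _), Set.image_image]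
    simp [insert_union]

end Complexes

/-! ### Joins with a simplex and with its boundary -/

section Joins

variable {ι I : Type} [Fintype ι]

/-- The facets of the join of the full simplex on `ι` and the complex with facets `F`. -/
def simplexJoinFacets (ι : Type) {I : Type} [Fintype ι] (F : Set (Finset I)) :
    Set (Finset (ι ⊕ I)) :=
  univ.disjSum '' F

/-- The facets of the join of the boundary of the simplex on `ι` and the complex with
facets `F`. -/
def simplexBoundaryJoinFacets (ι : Type) {I : Type} [Fintype ι] [DecidableEq ι]
    (F : Set (Finset I)) : Set (Finset (ι ⊕ I)) :=
  Set.image2 (fun i e => (univ.erase i).disjSum e) Set.univ F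

theorem sized_simplexJoinFacets {F : Set (Finset I)} {r : ℕ} (hF : F.Sized r) :
    (simplexJoinFacets ι F).Sized (Fintype.card ι + r) := by
  rintro _ ⟨e, he, rfl⟩
  rw [card_disjSum, card_univ, hF he]

variable [DecidableEq ι]

theorem sized_simplexBoundaryJoinFacets {F : Set (Finset I)} {r : ℕ} (hF : F.Sized r) :
    (simplexBoundaryJoinFacets ι F).Sized (Fintype.card ι - 1 + r) := by
  rintro _ ⟨i, -, e, he, rfl⟩
  rw [card_disjSum, card_erase_of_mem (mem_univ i), card_univ, hF he]

theorem ncard_simplexBoundaryJoinFacets (F : Set (Finset I)) :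
    (simplexBoundaryJoinFacets ι F).ncard = Fintype.card ι * F.ncard := by
  have hinj : Function.Injective2 fun (i : ι) (e : Finset I) => (univ.erase i).disjSum e :=
    fun i i' e e' h => by
      rw [disjSum_inj] at h
      exact ⟨(erase_inj univ (mem_univ i)).mp h.1, h.2⟩
  rw [simplexBoundaryJoinFacets, ← Set.image_uncurry_prod,
    Set.ncard_image_of_injective _ hinj.uncurry, Set.ncard_prod, Set.ncard_univ,
    Nat.card_eq_fintype_card]

theorem mem_simplexBoundaryJoinFacets_iff_card [Nonempty ι] {F : Set (Finset I)} {r : ℕ}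
    (hF : F.Sized r) {u : Finset (ι ⊕ I)} :
    u ∈ simplexBoundaryJoinFacets ι F ↔ u.card + 1 = Fintype.card ι + r ∧ u.toRight ∈ F := by
  constructor
  · rintro ⟨i, -, e, he, rfl⟩
    have hpos : 0 < Fintype.card ι := Fintype.card_pos
    rw [card_disjSum, card_erase_of_mem (mem_univ i), card_univ, hF he, toRight_disjSum]
    exact ⟨by omega, he⟩
  · rintro ⟨hcard, hu⟩
    rw [← card_toLeft_add_card_toRight, hF hu] at hcard
    obtain ⟨i, hi, hins⟩ : ∃ i ∉ u.toLeft, insert i u.toLeft = univ :=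
      exists_eq_insert_iff.mpr ⟨subset_univ _, by rw [card_univ]; omega⟩
    refine ⟨i, trivial, u.toRight, hu, ?_⟩
    simp only [← hins, erase_insert hi, toLeft_disjSum_toRight]

theorem boundary_closure_simplexJoinFacets [Nonempty ι] {F : Set (Finset I)} {r : ℕ}
    (hF : F.Sized r) (hclosed : ∀ e ∈ F, ∀ t ⊂ e, ∃ e' ∈ F, e' ≠ e ∧ t ⊆ e') :
    boundary (closure (simplexJoinFacets ι F)) = closure (simplexBoundaryJoinFacets ι F) := by
  have hpos : 0 < Fintype.card ι := Fintype.card_pos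
  have subset_iff : ∀ (u : Finset (ι ⊕ I)) (e : Finset I),
      u ⊆ univ.disjSum e ↔ u.toRight ⊆ e := fun u e => by simp [subset_disjSum]
  rw [boundary, facets_closure_of_sized (sized_simplexJoinFacets hF) (by omega)]
  congr 1
  ext u
  simp only [Set.mem_ofPred_eq, mem_simplexBoundaryJoinFacets_iff_card hF, simplexJoinFacets,
    Set.exists_mem_image, Set.forall_mem_image, subset_iff, disjSum_inj, true_and, card_disjSum,
    card_univ]
  constructor
  · rintro ⟨e, he, hue, hcard, huniq⟩
    rcases hue.eq_or_ssubset with heq | hlt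
    · exact ⟨by rw [hcard, hF he], heq ▸ he⟩
    · obtain ⟨e', he', hne, hue'⟩ := hclosed e he _ hlt
      exact absurd (huniq he' hue') hne
  · rintro ⟨hcard, hu⟩
    exact ⟨u.toRight, hu, Subset.rfl, by rw [hcard, hF hu],
      fun e he hue => (hF.isAntichain.eq hu he hue).symm⟩

end Joins

/-! ### Geometric realizations -/

section Realization

variable {V W : Type} [Fintype V] [Fintype W]

theorem mem_faces_filter_ne_zero_iff {K : PreAbstractSimplicialComplex V} {x : V → ℝ}
    (hx : x ∈ stdSimplex ℝ V) :
    univ.filter (fun v => x v ≠ 0) ∈ K.faces ↔ ∃ s ∈ K.faces, ∀ v ∉ s, x v = 0 := by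
  refine ⟨fun h => ⟨_, h, fun v hv => by simpa using hv⟩, ?_⟩
  rintro ⟨s, hs, hxs⟩
  refine (K.isRelLowerSet_faces hs).2 (fun v hv => ?_) ?_
  · exact not_imp_comm.mp (hxs v) (mem_filter.mp hv).2
  · obtain ⟨v, -, hv⟩ := exists_ne_zero_of_sum_ne_zero (hx.2.trans_ne one_ne_zero)
    exact ⟨v, by simpa using hv⟩

theorem isCompact_realization (K : PreAbstractSimplicialComplex V) :
    IsCompact (realization K) := by
  have h : realization K = ⋃ s : K.faces, stdSimplex ℝ V ∩ ⋂ v ∉ s.1, {x | x v = 0} := by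
    ext x
    simp only [realization, Set.mem_ofPred_eq, Set.mem_iUnion, Set.mem_inter_iff, Set.mem_iInter,
      exists_and_left, Subtype.exists, exists_prop]
    exact and_congr_right mem_faces_filter_ne_zero_iff
  rw [h]
  exact isCompact_iUnion fun s => (isCompact_stdSimplex ℝ V).inter_right <|
    isClosed_biInter fun v _ => isClosed_eq (continuous_apply v) continuous_const

theorem mem_realization_closure {F : Set (Finset V)} {x : V → ℝ} :
    x ∈ realization (closure F) ↔ x ∈ stdSimplex ℝ V ∧ ∃ t ∈ F, ∀ v ∉ t, x v = 0 := by
  refine and_congr_right fun hx => (mem_faces_filter_ne_zero_iff hx).trans ⟨?_, ?_⟩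
  · rintro ⟨s, ⟨-, t, ht, hst⟩, hxs⟩
    exact ⟨t, ht, fun v hv => hxs v (notMem_mono hst hv)⟩
  · rintro ⟨t, ht, hxt⟩
    obtain ⟨v, -, hv⟩ := exists_ne_zero_of_sum_ne_zero (hx.2.trans_ne one_ne_zero)
    exact ⟨t, ⟨⟨v, not_imp_comm.mp (hxt v) hv⟩, t, ht, Subset.rfl⟩, hxt⟩

theorem mem_realization_map [DecidableEq W] (K : PreAbstractSimplicialComplex V) (e : V ≃ W)
    {y : W → ℝ} : y ∈ realization (K.map e) ↔ y ∘ e ∈ realization K := by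
  have hsupp : univ.filter (fun w => y w ≠ 0) = (univ.filter fun v => y (e v) ≠ 0).image e := by
    ext w
    obtain ⟨v, rfl⟩ := e.surjective w
    simp
  have hsimplex : y ∈ stdSimplex ℝ W ↔ y ∘ e ∈ stdSimplex ℝ V := by
    simp [stdSimplex, ← e.forall_congr_right (q := fun w => 0 ≤ y w), ← e.sum_comp y]
  simp only [realization, Set.mem_ofPred_eq, hsimplex, hsupp, Function.comp_apply]
  exact and_congr_right fun _ => (image_injective e.injective).mem_set_image

theorem nonempty_realization_homeomorph_map [DecidableEq W] (K : PreAbstractSimplicialComplex V)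
    (e : V ≃ W) : Nonempty (realization (K.map e) ≃ₜ realization K) :=
  ⟨(Homeomorph.piCongrLeft (Y := fun _ => ℝ) e).symm.subtype fun _ => mem_realization_map K e⟩

theorem IsSimplicialBall.map [DecidableEq W] {D : ℕ} {K : PreAbstractSimplicialComplex V}
    (hK : IsSimplicialBall D K) (e : V ≃ W) : IsSimplicialBall D (K.map e) :=
  (nonempty_realization_homeomorph_map K e).map2 .trans hK

theorem IsSimplicialSphere.map [DecidableEq W] {d : ℕ} {K : PreAbstractSimplicialComplex V}
    (hK : IsSimplicialSphere d K) (e : V ≃ W) : IsSimplicialSphere d (K.map e) :=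
  (nonempty_realization_homeomorph_map K e).map2 .trans hK

end Realization

/-! ### Convex bodies -/

section ConvexBodies

theorem frontier_iInter_preimage_Iic {F κ : Type*} [NormedAddCommGroup F] [NormedSpace ℝ F]
    [Finite κ] {f : κ → F →L[ℝ] ℝ} (hf : ∀ i, f i ≠ 0) (c : κ → ℝ) :
    frontier (⋂ i, f i ⁻¹' Set.Iic (c i)) =
      {y | (∀ i, f i y ≤ c i) ∧ ∃ i, f i y = c i} := by
  have hclosed : IsClosed (⋂ i, f i ⁻¹' Set.Iic (c i)) :=
    isClosed_iInter fun i => isClosed_Iic.preimage (f i).continuous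
  have hint : ∀ i, interior (f i ⁻¹' Set.Iic (c i)) = f i ⁻¹' Set.Iio (c i) := fun i => by
    rw [← IsOpenMap.preimage_interior_eq_interior_preimage ((f i).isOpenMap_of_ne_zero (hf i))
      (f i).continuous, interior_Iic]
  rw [hclosed.frontier_eq, interior_iInter_of_finite]
  ext y
  simp only [hint, Set.mem_sdiff, Set.mem_iInter, Set.mem_preimage, Set.mem_Iic, Set.mem_Iio,
    Set.mem_ofPred_eq, not_forall, not_lt]
  exact and_congr_right fun h => exists_congr fun i => (h i).ge_iff_eq

theorem nonempty_homeomorph_image {X Y : Type*} [TopologicalSpace X] [TopologicalSpace Y]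
    [T2Space Y] {K : Set X} (hK : IsCompact K) {f : X → Y} (hf : Continuous f)
    (hinj : Set.InjOn f K) : Nonempty (K ≃ₜ f '' K) := by
  have : CompactSpace K := isCompact_iff_compactSpace.mp hK
  have hc : Continuous (Equiv.Set.imageOfInjOn f K hinj) :=
    Continuous.subtype_mk (hf.comp continuous_subtype_val) _
  exact ⟨hc.homeoOfEquivCompactToT2⟩

theorem exists_homeomorph_image_eq_unitBall {F : Type*} [NormedAddCommGroup F] [NormedSpace ℝ F]
    [FiniteDimensional ℝ F] {N : ℕ} (hN : Module.finrank ℝ F = N) {s : Set F}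
    (hs : IsCompact s) (hconv : Convex ℝ s) (hne : (interior s).Nonempty) :
    ∃ h : F ≃ₜ EuclideanSpace ℝ (Fin N),
      h '' s = Metric.closedBall 0 1 ∧ h '' frontier s = Metric.sphere 0 1 := by
  let A : F ≃L[ℝ] EuclideanSpace ℝ (Fin N) := ContinuousLinearEquiv.ofFinrankEq (by simp [hN])
  have hcompact : IsCompact (A.toHomeomorph '' s) := hs.image A.continuous
  obtain ⟨h, -, hclosure, hfrontier⟩ :=
    exists_homeomorph_image_interior_closure_frontier_eq_unitBall (s := A.toHomeomorph '' s)
      (hconv.linear_image A.toLinearEquiv.toLinearMap)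
      (by rw [← Homeomorph.image_interior]; exact hne.image _) hcompact.isBounded
  rw [hcompact.isClosed.closure_eq, ← Set.image_comp] at hclosure
  rw [← Homeomorph.image_frontier, ← Set.image_comp] at hfrontier
  exact ⟨A.toHomeomorph.trans h, hclosure, hfrontier⟩

variable {V F : Type} [Fintype V] [NormedAddCommGroup F] [NormedSpace ℝ F]
  [FiniteDimensional ℝ F] {N : ℕ} {f : (V → ℝ) → F} {s : Set F}

theorem isSimplicialBall_of_image_eq (hN : Module.finrank ℝ F = N)
    {K : PreAbstractSimplicialComplex V} (hf : Continuous f)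
    (hinj : Set.InjOn f (realization K)) (hK : f '' realization K = s) (hconv : Convex ℝ s)
    (hne : (interior s).Nonempty) : IsSimplicialBall N K := by
  have hcompact : IsCompact (realization K) := isCompact_realization K
  obtain ⟨h, hball, -⟩ :=
    exists_homeomorph_image_eq_unitBall hN (hK ▸ hcompact.image hf) hconv hne
  rw [← hK, ← Set.image_comp] at hball
  rw [IsSimplicialBall, ← hball]
  exact nonempty_homeomorph_image hcompact (h.continuous.comp hf) (h.injective.comp_injOn hinj)

theorem isSimplicialSphere_of_image_eq_frontier (hN : Module.finrank ℝ F = N + 1)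
    {K : PreAbstractSimplicialComplex V} (hf : Continuous f)
    (hinj : Set.InjOn f (realization K)) (hK : f '' realization K = frontier s)
    (hs : IsCompact s) (hconv : Convex ℝ s) (hne : (interior s).Nonempty) :
    IsSimplicialSphere N K := by
  obtain ⟨h, -, hsphere⟩ := exists_homeomorph_image_eq_unitBall hN hs hconv hne
  rw [← hK, ← Set.image_comp] at hsphere
  rw [IsSimplicialSphere, ← hsphere]
  exact nonempty_homeomorph_image (isCompact_realization K) (h.continuous.comp hf)
    (h.injective.comp_injOn hinj)

end ConvexBodies

section JoinRealization

variable {ι I : Type} [Fintype ι] [Fintype I] {F : Set (Finset I)} {x : ι ⊕ I → ℝ}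

theorem mem_realization_simplexJoin : x ∈ realization (closure (simplexJoinFacets ι F)) ↔
    x ∈ stdSimplex ℝ (ι ⊕ I) ∧ ∃ e ∈ F, ∀ i ∉ e, x (.inr i) = 0 := by
  simp [mem_realization_closure, simplexJoinFacets]

theorem mem_realization_simplexBoundaryJoin [DecidableEq ι] :
    x ∈ realization (closure (simplexBoundaryJoinFacets ι F)) ↔
      x ∈ realization (closure (simplexJoinFacets ι F)) ∧ ∃ i, x (.inl i) = 0 := by
  rw [mem_realization_simplexJoin]
  simp only [mem_realization_closure, simplexBoundaryJoinFacets,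
    Set.exists_mem_image2, Sum.forall, inl_mem_disjSum, inr_mem_disjSum, mem_erase, mem_univ,
    and_true, not_not, forall_eq, Set.mem_univ, true_and]
  grind

theorem sum_inl_add_sum_inr_of_mem_stdSimplex {d : ℕ} {x : Fin (d + 1) ⊕ I → ℝ}
    (hx : x ∈ stdSimplex ℝ (Fin (d + 1) ⊕ I)) :
    x (.inl 0) + ∑ i : Fin d, x (.inl i.succ) + ∑ i, x (.inr i) = 1 := by
  rw [← hx.2, Fintype.sum_sum_type, Fin.sum_univ_succ]

end JoinRealization

/-! ### Simplicial polytopes -/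

section SimplicialPolytopes

/-- A simplicial polytope in `F` with the origin in its interior: vertices indexed by `I`, facets
indexed by `J`. The facet `j` is cut out by the inequality `normal j ≤ 1`, and the cones over the
facets are simplicial and cover the space. -/
structure SimplicialPolytope (I J F : Type) [Fintype I] [NormedAddCommGroup F]
    [NormedSpace ℝ F] where
  vertex : I → F
  facet : J → Finset I
  normal : J → F →L[ℝ] ℝ
  facet_nonempty (j : J) : (facet j).Nonempty
  normal_eq_one {j : J} {i : I} : i ∈ facet j → normal j (vertex i) = 1
  normal_lt_one {j : J} {i : I} : i ∉ facet j → normal j (vertex i) < 1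
  linearIndepOn_facet (j : J) : LinearIndepOn ℝ vertex (facet j)
  exists_sum_eq (w : F) : ∃ (j : J) (y : I → ℝ),
    (∀ i, 0 ≤ y i) ∧ (∀ i ∉ facet j, y i = 0) ∧ ∑ i, y i • vertex i = w

namespace SimplicialPolytope

variable {I J F : Type} [Fintype I] [NormedAddCommGroup F] [NormedSpace ℝ F]
  (P : SimplicialPolytope I J F) {y z : I → ℝ}

theorem normal_vertex_le_one (j : J) (i : I) : P.normal j (P.vertex i) ≤ 1 := by
  by_cases hi : i ∈ P.facet j
  · exact (P.normal_eq_one hi).le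
  · exact (P.normal_lt_one hi).le

theorem normal_sum_le (hy : ∀ i, 0 ≤ y i) (j : J) :
    P.normal j (∑ i, y i • P.vertex i) ≤ ∑ i, y i := by
  simp only [map_sum, map_smul, smul_eq_mul]
  exact sum_le_sum fun i _ => mul_le_of_le_one_right (hy i) (P.normal_vertex_le_one j i)

theorem normal_sum_eq_iff (hy : ∀ i, 0 ≤ y i) (j : J) :
    P.normal j (∑ i, y i • P.vertex i) = ∑ i, y i ↔ ∀ i ∉ P.facet j, y i = 0 := by
  simp only [map_sum, map_smul, smul_eq_mul]
  rw [sum_eq_sum_iff_of_le fun i _ =>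
    mul_le_of_le_one_right (hy i) (P.normal_vertex_le_one j i)]
  refine ⟨fun h i hi => ?_, fun h i _ => ?_⟩
  · exact (mul_right_eq_self₀.mp (h i (mem_univ i))).resolve_left (P.normal_lt_one hi).ne
  · by_cases hi : i ∈ P.facet j
    · rw [P.normal_eq_one hi, mul_one]
    · rw [h i hi, zero_mul]

theorem eq_of_sum_eq (hy : ∀ i, 0 ≤ y i) (hz : ∀ i, 0 ≤ z i) {j l : J}
    (hyj : ∀ i ∉ P.facet j, y i = 0) (hzl : ∀ i ∉ P.facet l, z i = 0)
    (h : ∑ i, y i • P.vertex i = ∑ i, z i • P.vertex i) : y = z := by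
  have hy_sum := (P.normal_sum_eq_iff hy j).mpr hyj
  have hz_sum := (P.normal_sum_eq_iff hz l).mpr hzl
  have hsum : ∑ i, y i = ∑ i, z i := by
    refine le_antisymm ?_ ?_
    · rw [← hy_sum, h]
      exact P.normal_sum_le hz j
    · rw [← hz_sum, ← h]
      exact P.normal_sum_le hy l
  have hzj : ∀ i ∉ P.facet j, z i = 0 :=
    (P.normal_sum_eq_iff hz j).mp (by rw [← h, hy_sum, hsum])
  have hdiff : ∑ i ∈ P.facet j, (y i - z i) • P.vertex i = 0 := by
    rw [sum_subset (subset_univ _) fun i _ hi => by rw [hyj i hi, hzj i hi, sub_zero, zero_smul]]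
    simp only [sub_smul, sum_sub_distrib, h, sub_self]
  funext i
  by_cases hi : i ∈ P.facet j
  · exact sub_eq_zero.mp (linearIndepOn_finset_iff.mp (P.linearIndepOn_facet j) _ hdiff i hi)
  · rw [hyj i hi, hzj i hi]

variable {d : ℕ}

/-- The linear forms defining `P.freeSum d`. -/
def freeSumForm : Fin d ⊕ J → ((Fin d → ℝ) × F) →L[ℝ] ℝ
  | .inl i => -((ContinuousLinearMap.proj i).comp (ContinuousLinearMap.fst ℝ _ _))
  | .inr j => (∑ i, ContinuousLinearMap.proj i).comp (ContinuousLinearMap.fst ℝ _ _) +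
      (P.normal j).comp (ContinuousLinearMap.snd ℝ _ _)

@[simp]
theorem freeSumForm_inl (i : Fin d) (y : (Fin d → ℝ) × F) :
    P.freeSumForm (.inl i) y = -y.1 i := by
  simp [freeSumForm]

@[simp]
theorem freeSumForm_inr (j : J) (y : (Fin d → ℝ) × F) :
    P.freeSumForm (.inr j) y = ∑ i, y.1 i + P.normal j y.2 := by
  simp [freeSumForm]

theorem freeSumForm_ne_zero (k : Fin d ⊕ J) : P.freeSumForm k ≠ 0 := by
  intro h
  rcases k with i | j
  · simpa using DFunLike.congr_fun h (Pi.single i 1, 0)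
  · obtain ⟨i, hi⟩ := P.facet_nonempty j
    simpa [P.normal_eq_one hi] using DFunLike.congr_fun h (0, P.vertex i)

/-- The convex hull of `P` and the standard `d`-simplex with one vertex at the origin, in
complementary subspaces. -/
def freeSum (d : ℕ) : Set ((Fin d → ℝ) × F) :=
  ⋂ k, P.freeSumForm k ⁻¹' Set.Iic (Sum.elim 0 1 k)

theorem mem_freeSum {y : (Fin d → ℝ) × F} : y ∈ P.freeSum d ↔
    (∀ i, 0 ≤ y.1 i) ∧ ∀ j, ∑ i, y.1 i + P.normal j y.2 ≤ 1 := by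
  simp [freeSum]

theorem mem_frontier_freeSum [Finite J] {y : (Fin d → ℝ) × F} :
    y ∈ frontier (P.freeSum d) ↔ y ∈ P.freeSum d ∧
      ((∃ i, y.1 i = 0) ∨ ∃ j, ∑ i, y.1 i + P.normal j y.2 = 1) := by
  rw [freeSum, frontier_iInter_preimage_Iic P.freeSumForm_ne_zero]
  simp

theorem convex_freeSum : Convex ℝ (P.freeSum d) :=
  convex_iInter fun k => (convex_Iic _).linear_preimage (P.freeSumForm k).toLinearMap

theorem interior_freeSum_nonempty [Finite J] : (interior (P.freeSum d)).Nonempty := by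
  have hpos : (0 : ℝ) < d + 1 := by positivity
  have hlt : (d : ℝ) * ((d : ℝ) + 1)⁻¹ < 1 := by
    rw [← div_eq_mul_inv, div_lt_one hpos]
    exact lt_add_one _
  let y : (Fin d → ℝ) × F := (fun _ => ((d : ℝ) + 1)⁻¹, 0)
  have hy : y ∈ P.freeSum d :=
    P.mem_freeSum.mpr ⟨fun _ => (inv_pos.mpr hpos).le, fun _ => by simpa [y] using hlt.le⟩
  refine ⟨y, by_contra fun hint => ?_⟩
  obtain ⟨-, ⟨_, hi⟩ | ⟨_, hj⟩⟩ := P.mem_frontier_freeSum.mp ⟨subset_closure hy, hint⟩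
  · exact (inv_pos.mpr hpos).ne' hi
  · exact hlt.ne (by simpa [y] using hj)

/-- The affine extension of the vertex placement of the free sum: the first vertex of the simplex
is sent to the origin, the others to the standard basis. -/
def joinMap (x : Fin (d + 1) ⊕ I → ℝ) : (Fin d → ℝ) × F :=
  (fun i => x (.inl i.succ), ∑ i, x (.inr i) • P.vertex i)

theorem continuous_joinMap : Continuous (P.joinMap (d := d)) := by
  unfold joinMap
  fun_prop

theorem injOn_joinMap : Set.InjOn P.joinMap
    (realization (closure (simplexJoinFacets (Fin (d + 1)) (Set.range P.facet)))) := by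
  intro x hx y hy h
  simp only [mem_realization_simplexJoin, Set.exists_range_iff] at hx hy
  obtain ⟨hx, j, hxj⟩ := hx
  obtain ⟨hy, l, hyl⟩ := hy
  have hsucc (i : Fin d) : x (.inl i.succ) = y (.inl i.succ) := congrFun (congrArg Prod.fst h) i
  have hinr (i : I) : x (.inr i) = y (.inr i) :=
    congrFun (P.eq_of_sum_eq (fun i => hx.1 (.inr i)) (fun i => hy.1 (.inr i)) hxj hyl
      (congrArg Prod.snd h)) i
  have hzero : x (.inl 0) = y (.inl 0) := by
    have hx_sum := sum_inl_add_sum_inr_of_mem_stdSimplex hx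
    have hy_sum := sum_inl_add_sum_inr_of_mem_stdSimplex hy
    simp only [hsucc, hinr] at hx_sum
    linarith
  funext v
  rcases v with i | i
  · exact Fin.cases hzero hsucc i
  · exact hinr i

theorem joinMap_mem_freeSum {x : Fin (d + 1) ⊕ I → ℝ}
    (hx : x ∈ stdSimplex ℝ (Fin (d + 1) ⊕ I)) : P.joinMap x ∈ P.freeSum d := by
  refine P.mem_freeSum.mpr ⟨fun i => hx.1 _, fun j => ?_⟩
  have hnormal := P.normal_sum_le (fun i => hx.1 (.inr i)) j
  have hsum := sum_inl_add_sum_inr_of_mem_stdSimplex hx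
  have hzero := hx.1 (.inl 0)
  simp only [joinMap]
  linarith

theorem exists_joinMap_eq {w : (Fin d → ℝ) × F} (hw : w ∈ P.freeSum d) :
    ∃ x ∈ realization (closure (simplexJoinFacets (Fin (d + 1)) (Set.range P.facet))),
      P.joinMap x = w := by
  obtain ⟨hnonneg, hnormal⟩ := P.mem_freeSum.mp hw
  obtain ⟨j, z, hz, hzj, hzw⟩ := P.exists_sum_eq w.2
  have hj := hnormal j
  rw [← hzw, (P.normal_sum_eq_iff hz j).mpr hzj] at hj
  let x : Fin (d + 1) ⊕ I → ℝ := Sum.elim (Fin.cons (1 - ∑ i, w.1 i - ∑ i, z i) w.1) z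
  have hx_nonneg : ∀ v, 0 ≤ x v := by
    rintro (i | i)
    · refine Fin.cases ?_ (fun i => ?_) i
      · simp only [x, Sum.elim_inl, Fin.cons_zero]
        linarith
      · exact hnonneg i
    · exact hz i
  have hx_sum : ∑ v, x v = 1 := by
    rw [Fintype.sum_sum_type, Fin.sum_univ_succ]
    simp only [x, Sum.elim_inl, Sum.elim_inr, Fin.cons_zero, Fin.cons_succ]
    ring
  exact ⟨x, mem_realization_simplexJoin.mpr ⟨⟨hx_nonneg, hx_sum⟩, _, ⟨j, rfl⟩, hzj⟩,
    Prod.ext rfl hzw⟩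

theorem image_joinMap : P.joinMap '' realization
    (closure (simplexJoinFacets (Fin (d + 1)) (Set.range P.facet))) = P.freeSum d := by
  refine Set.Subset.antisymm ?_ fun w hw => P.exists_joinMap_eq hw
  rintro _ ⟨x, hx, rfl⟩
  exact P.joinMap_mem_freeSum hx.1

theorem joinMap_mem_frontier_iff [Finite J] {x : Fin (d + 1) ⊕ I → ℝ}
    (hx : x ∈ realization (closure (simplexJoinFacets (Fin (d + 1)) (Set.range P.facet)))) :
    P.joinMap x ∈ frontier (P.freeSum d) ↔ ∃ i, x (.inl i) = 0 := by
  have hmem := P.joinMap_mem_freeSum hx.1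
  obtain ⟨hx, _, ⟨j, rfl⟩, hj⟩ := mem_realization_simplexJoin.mp hx
  have hnonneg (i : I) : 0 ≤ x (.inr i) := hx.1 _
  have hsum := sum_inl_add_sum_inr_of_mem_stdSimplex hx
  have hface : (∃ l, ∑ i : Fin d, x (.inl i.succ) + P.normal l (∑ i, x (.inr i) • P.vertex i) = 1)
      ↔ x (.inl 0) = 0 := by
    constructor
    · rintro ⟨l, hl⟩
      have hle := P.normal_sum_le hnonneg l
      have hzero := hx.1 (.inl 0)
      linarith
    · intro hzero
      refine ⟨j, ?_⟩
      rw [(P.normal_sum_eq_iff hnonneg j).mpr hj]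
      linarith
  rw [mem_frontier_freeSum, and_iff_right hmem, Fin.exists_fin_succ, or_comm]
  exact or_congr_left hface

theorem image_joinMap_boundary [Finite J] : P.joinMap '' realization
    (closure (simplexBoundaryJoinFacets (Fin (d + 1)) (Set.range P.facet))) =
      frontier (P.freeSum d) := by
  ext w
  constructor
  · rintro ⟨x, hx, rfl⟩
    rw [mem_realization_simplexBoundaryJoin] at hx
    exact (P.joinMap_mem_frontier_iff hx.1).mpr hx.2
  · intro hw
    obtain ⟨x, hx, rfl⟩ := P.exists_joinMap_eq (P.mem_frontier_freeSum.mp hw).1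
    exact ⟨x, mem_realization_simplexBoundaryJoin.mpr
      ⟨hx, (P.joinMap_mem_frontier_iff hx).mp hw⟩, rfl⟩

variable [FiniteDimensional ℝ F] [Finite J]

theorem isSimplicialBall_simplexJoin :
    IsSimplicialBall (d + Module.finrank ℝ F)
      (closure (simplexJoinFacets (Fin (d + 1)) (Set.range P.facet))) :=
  isSimplicialBall_of_image_eq (by simp) P.continuous_joinMap P.injOn_joinMap P.image_joinMap
    P.convex_freeSum P.interior_freeSum_nonempty

theorem isSimplicialSphere_simplexBoundaryJoin {r : ℕ} (hr : Module.finrank ℝ F = r + 1) :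
    IsSimplicialSphere (d + r)
      (closure (simplexBoundaryJoinFacets (Fin (d + 1)) (Set.range P.facet))) :=
  isSimplicialSphere_of_image_eq_frontier (by simp [hr, add_assoc]) P.continuous_joinMap
    (P.injOn_joinMap.mono fun _ hx => (mem_realization_simplexBoundaryJoin.mp hx).1)
    P.image_joinMap_boundary
    (P.image_joinMap ▸ (isCompact_realization _).image P.continuous_joinMap)
    P.convex_freeSum P.interior_freeSum_nonempty

end SimplicialPolytope

end SimplicialPolytopes

/-! ### Cycles and polygons -/

section Cycles

variable {m : ℕ}

/-- The edges of the cycle `0, 1, …, m - 1, 0`. -/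
def cycleEdge (j : ZMod m) : Finset (ZMod m) := {j, j + 1}

theorem one_add_one_ne_zero_of_three_le (hm : 3 ≤ m) : (1 + 1 : ZMod m) ≠ 0 := by
  intro h
  have hdvd : m ∣ 2 := (ZMod.natCast_eq_zero_iff 2 m).mp (by push_cast; rwa [← one_add_one_eq_two])
  exact absurd (Nat.le_of_dvd two_pos hdvd) (by omega)

theorem one_ne_zero_of_three_le (hm : 3 ≤ m) : (1 : ZMod m) ≠ 0 := fun h =>
  one_add_one_ne_zero_of_three_le hm (by rw [h, add_zero])

theorem notMem_cycleEdge_add_one (hm : 3 ≤ m) (j : ZMod m) : j ∉ cycleEdge (j + 1) := by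
  simp [cycleEdge, add_assoc, one_ne_zero_of_three_le hm, one_add_one_ne_zero_of_three_le hm]

theorem add_one_notMem_cycleEdge_sub_one (hm : 3 ≤ m) (j : ZMod m) :
    j + 1 ∉ cycleEdge (j - 1) := by
  rw [cycleEdge, sub_add_cancel, mem_insert, mem_singleton, eq_sub_iff_add_eq, add_assoc]
  simp [one_ne_zero_of_three_le hm, one_add_one_ne_zero_of_three_le hm]

theorem card_cycleEdge (hm : 3 ≤ m) (j : ZMod m) : #(cycleEdge j) = 2 :=
  card_pair (by simp [one_ne_zero_of_three_le hm])

theorem sized_range_cycleEdge (hm : 3 ≤ m) : (Set.range (cycleEdge (m := m))).Sized 2 := by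
  rintro _ ⟨j, rfl⟩
  exact card_cycleEdge hm j

theorem cycleEdge_injective (hm : 3 ≤ m) : Function.Injective (cycleEdge (m := m)) := by
  intro j l h
  have hj : j ∈ cycleEdge l := h ▸ mem_insert_self _ _
  rcases mem_insert.mp hj with hj | hj
  · exact hj
  · refine absurd ?_ (notMem_cycleEdge_add_one hm l)
    rw [← mem_singleton.mp hj, h]
    exact mem_insert_self _ _

theorem exists_ne_cycleEdge_of_ssubset (hm : 3 ≤ m) {j : ZMod m} {t : Finset (ZMod m)}
    (ht : t ⊂ cycleEdge j) : ∃ l, cycleEdge l ≠ cycleEdge j ∧ t ⊆ cycleEdge l := by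
  obtain ⟨x, hx, hxt⟩ := exists_of_ssubset ht
  have hsub : t ⊆ (cycleEdge j).erase x := subset_erase.mpr ⟨ht.subset, hxt⟩
  rcases mem_insert.mp hx with rfl | hx
  · refine ⟨x + 1, fun h => notMem_cycleEdge_add_one hm x (h ▸ mem_insert_self _ _),
      hsub.trans fun y hy => ?_⟩
    simp only [cycleEdge, mem_erase, mem_insert, mem_singleton] at hy ⊢
    exact Or.inl (hy.2.resolve_left hy.1)
  · rw [mem_singleton.mp hx] at hsub
    refine ⟨j - 1, fun h => add_one_notMem_cycleEdge_sub_one hm j (h ▸ by simp [cycleEdge]),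
      hsub.trans fun y hy => ?_⟩
    simp only [cycleEdge, mem_erase, mem_insert, mem_singleton, sub_add_cancel] at hy ⊢
    exact Or.inr (hy.2.resolve_right hy.1)

end Cycles

section Polygons

variable {m : ℕ} {F : Type} [NormedAddCommGroup F] [NormedSpace ℝ F]
  {vertex : ZMod m → F} {normal : ZMod m → F →L[ℝ] ℝ}

theorem linearIndependent_pair_of_normal (hm : 3 ≤ m)
    (h_eq : ∀ j, ∀ i ∈ cycleEdge j, normal j (vertex i) = 1)
    (h_lt : ∀ j, ∀ i ∉ cycleEdge j, normal j (vertex i) < 1) (j : ZMod m) :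
    LinearIndependent ℝ ![vertex j, vertex (j + 1)] := by
  refine LinearIndependent.pair_iff.mpr fun a b hab => ?_
  have hj := congrArg (normal j) hab
  have hj' := congrArg (normal (j + 1)) hab
  simp only [map_add, map_smul, smul_eq_mul, map_zero, h_eq j j (by simp [cycleEdge]),
    h_eq j (j + 1) (by simp [cycleEdge]), h_eq (j + 1) (j + 1) (by simp [cycleEdge])] at hj hj'
  have hne := h_lt (j + 1) j (notMem_cycleEdge_add_one hm j)
  have ha : a = 0 := by
    by_contra ha
    exact hne.ne (mul_left_cancel₀ ha (by linarith))
  exact ⟨ha, by linarith⟩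

theorem exists_smul_add_smul_eq_of_normal [NeZero m] (hm : 3 ≤ m)
    (hF : Module.finrank ℝ F = 2)
    (h_eq : ∀ j, ∀ i ∈ cycleEdge j, normal j (vertex i) = 1)
    (h_lt : ∀ j, ∀ i ∉ cycleEdge j, normal j (vertex i) < 1) (w : F) :
    ∃ (j : ZMod m) (a b : ℝ), 0 ≤ a ∧ 0 ≤ b ∧ a • vertex j + b • vertex (j + 1) = w := by
  obtain ⟨j, hj⟩ := Finite.exists_max fun j => normal j w
  have : FiniteDimensional ℝ F := .of_finrank_pos (by omega)
  have hspan := (linearIndependent_pair_of_normal hm h_eq h_lt j).span_eq_top_of_card_eq_finrank'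
    (by simp [hF])
  rw [Matrix.range_cons_cons_empty] at hspan
  obtain ⟨a, b, rfl⟩ := Submodule.mem_span_pair.mp (hspan ▸ Submodule.mem_top : w ∈ _)
  have h_next := hj (j + 1)
  have h_prev := hj (j - 1)
  simp only [map_add, map_smul, smul_eq_mul, h_eq j j (by simp [cycleEdge]),
    h_eq j (j + 1) (by simp [cycleEdge]), h_eq (j + 1) (j + 1) (by simp [cycleEdge]),
    h_eq (j - 1) j (by simp [cycleEdge])] at h_next h_prev
  have h_lt_next := h_lt (j + 1) j (notMem_cycleEdge_add_one hm j)
  have h_lt_prev := h_lt (j - 1) (j + 1) (add_one_notMem_cycleEdge_sub_one hm j)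
  refine ⟨j, a, b, ?_, ?_, rfl⟩
  · by_contra! ha
    nlinarith
  · by_contra! hb
    nlinarith

/-- The polygon with vertices `vertex j` in cyclic order, where the edge from `vertex j` to
`vertex (j + 1)` is supported by the line `normal j = 1`. -/
def polygon [NeZero m] (hm : 3 ≤ m) (hF : Module.finrank ℝ F = 2) (vertex : ZMod m → F)
    (normal : ZMod m → F →L[ℝ] ℝ) (h_eq : ∀ j, ∀ i ∈ cycleEdge j, normal j (vertex i) = 1)
    (h_lt : ∀ j, ∀ i ∉ cycleEdge j, normal j (vertex i) < 1) :
    SimplicialPolytope (ZMod m) (ZMod m) F where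
  vertex := vertex
  facet := cycleEdge
  normal := normal
  facet_nonempty j := insert_nonempty _ _
  normal_eq_one := h_eq _ _
  normal_lt_one := h_lt _ _
  linearIndepOn_facet j := by
    rw [cycleEdge, coe_pair, LinearIndepOn.pair_iff _ (by simp [one_ne_zero_of_three_le hm])]
    exact LinearIndependent.pair_iff.mp (linearIndependent_pair_of_normal hm h_eq h_lt j)
  exists_sum_eq w := by
    obtain ⟨j, a, b, ha, hb, rfl⟩ := exists_smul_add_smul_eq_of_normal hm hF h_eq h_lt w
    have hj : (0 : ZMod m → ℝ) ≤ Pi.single j a := Pi.single_nonneg.mpr ha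
    have hj' : (0 : ZMod m → ℝ) ≤ Pi.single (j + 1) b := Pi.single_nonneg.mpr hb
    refine ⟨j, Pi.single j a + Pi.single (j + 1) b, fun i => add_nonneg (hj i) (hj' i),
      fun i hi => ?_, ?_⟩
    · simp only [cycleEdge, mem_insert, mem_singleton, not_or] at hi
      simp [hi]
    · simp [add_smul, sum_add_distrib, Pi.single_apply, ite_smul]

theorem cos_le_cos_of_le_two_pi_sub {a t : ℝ} (ha : 0 ≤ a) (hat : a ≤ t)
    (hta : t ≤ 2 * Real.pi - a) : Real.cos t ≤ Real.cos a := by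
  rcases le_total t Real.pi with ht | ht
  · exact Real.cos_le_cos_of_nonneg_of_le_pi ha ht hat
  · rw [← Real.cos_two_pi_sub t]
    exact Real.cos_le_cos_of_nonneg_of_le_pi ha (by linarith) (by linarith)

theorem two_pi_div_mem_Ioo (hm : 3 ≤ m) : 2 * Real.pi / m ∈ Set.Ioo 0 Real.pi := by
  have hm' : (3 : ℝ) ≤ m := mod_cast hm
  have := Real.pi_pos
  exact ⟨by positivity, by rw [div_lt_iff₀ (by linarith)]; nlinarith⟩

variable [NeZero m]

theorem re_toCircle (t : ZMod m) :
    (ZMod.toCircle t : ℂ).re = Real.cos (t.val * (2 * Real.pi / m)) := by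
  rw [ZMod.toCircle_apply, ← Complex.exp_ofReal_mul_I_re]
  congr 2
  push_cast
  ring

theorem inner_toCircle (s t : ZMod m) :
    inner ℝ (ZMod.toCircle s : ℂ) (ZMod.toCircle t) = (ZMod.toCircle (t - s) : ℂ).re := by
  rw [Complex.inner, sub_eq_add_neg, AddChar.map_add_eq_mul, AddChar.map_neg_eq_inv,
    Circle.coe_mul, Circle.coe_inv_eq_conj, mul_comm]

theorem re_toCircle_neg (t : ZMod m) :
    (ZMod.toCircle (-t) : ℂ).re = (ZMod.toCircle t : ℂ).re := by
  rw [AddChar.map_neg_eq_inv, Circle.coe_inv_eq_conj, Complex.conj_re]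

theorem re_toCircle_one (hm : 3 ≤ m) :
    (ZMod.toCircle (1 : ZMod m) : ℂ).re = Real.cos (2 * Real.pi / m) := by
  have : Fact (1 < m) := ⟨by omega⟩
  rw [re_toCircle, ZMod.val_one, Nat.cast_one, one_mul]

theorem re_toCircle_le_re_toCircle_one (hm : 3 ≤ m) {t : ZMod m} (ht : t ≠ 0) :
    (ZMod.toCircle t : ℂ).re ≤ (ZMod.toCircle (1 : ZMod m) : ℂ).re := by
  have hpos := (two_pi_div_mem_Ioo hm).1
  have hval : (1 : ℝ) ≤ t.val := mod_cast Nat.one_le_iff_ne_zero.mpr (by simpa using ht)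
  have hval' : (t.val : ℝ) ≤ m - 1 := by
    rw [le_sub_iff_add_le]
    exact_mod_cast t.val_lt
  have hm' : m * (2 * Real.pi / m) = 2 * Real.pi := mul_div_cancel₀ _ (NeZero.ne _)
  rw [re_toCircle, re_toCircle_one hm]
  exact cos_le_cos_of_le_two_pi_sub hpos.le (by nlinarith) (by nlinarith)

theorem re_toCircle_one_mem_Ioo (hm : 3 ≤ m) :
    (ZMod.toCircle (1 : ZMod m) : ℂ).re ∈ Set.Ioo (-1) 1 := by
  obtain ⟨hpos, hlt⟩ := two_pi_div_mem_Ioo hm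
  rw [re_toCircle_one hm]
  constructor
  · simpa using Real.cos_lt_cos_of_nonneg_of_le_pi hpos.le le_rfl hlt
  · simpa using Real.cos_lt_cos_of_nonneg_of_le_pi le_rfl hlt.le hpos

theorem inner_toCircle_add_eq {i j : ZMod m} (hi : i ∈ cycleEdge j) :
    inner ℝ ((ZMod.toCircle j : ℂ) + ZMod.toCircle (j + 1)) (ZMod.toCircle i : ℂ) =
      1 + (ZMod.toCircle (1 : ZMod m) : ℂ).re := by
  simp only [cycleEdge, mem_insert, mem_singleton] at hi
  rw [inner_add_left, inner_toCircle, inner_toCircle]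
  rcases hi with rfl | rfl
  · simp [re_toCircle_neg]
  · simp [add_comm]

theorem inner_toCircle_add_lt (hm : 3 ≤ m) {i j : ZMod m} (hi : i ∉ cycleEdge j) :
    inner ℝ ((ZMod.toCircle j : ℂ) + ZMod.toCircle (j + 1)) (ZMod.toCircle i : ℂ) <
      1 + (ZMod.toCircle (1 : ZMod m) : ℂ).re := by
  simp only [cycleEdge, mem_insert, mem_singleton, not_or] at hi
  rw [inner_add_left, inner_toCircle, inner_toCircle]
  have hj := re_toCircle_le_re_toCircle_one hm (sub_ne_zero.mpr hi.1)
  have hj' := re_toCircle_le_re_toCircle_one hm (sub_ne_zero.mpr hi.2)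
  linarith [(re_toCircle_one_mem_Ioo hm).2]

/-- The regular `m`-gon inscribed in the unit circle. -/
noncomputable def regularPolygon (hm : 3 ≤ m) : SimplicialPolytope (ZMod m) (ZMod m) ℂ :=
  have hpos : 0 < 1 + (ZMod.toCircle (1 : ZMod m) : ℂ).re := by
    linarith [(re_toCircle_one_mem_Ioo hm).1]
  polygon hm Complex.finrank_real_complex (fun j => ZMod.toCircle j)
    (fun j => (1 + (ZMod.toCircle (1 : ZMod m) : ℂ).re)⁻¹ •
      innerSL ℝ ((ZMod.toCircle j : ℂ) + ZMod.toCircle (j + 1)))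
    (fun j i hi => by
      rw [smul_apply, innerSL_apply_apply, inner_toCircle_add_eq hi,
        smul_eq_mul, inv_mul_cancel₀ hpos.ne'])
    (fun j i hi => by
      rw [smul_apply, innerSL_apply_apply, smul_eq_mul, inv_mul_lt_one₀ hpos]
      exact inner_toCircle_add_lt hm hi)

theorem isSimplicialBall_simplexJoin_cycle (d : ℕ) (hm : 3 ≤ m) :
    IsSimplicialBall (d + 2)
      (closure (simplexJoinFacets (Fin (d + 1)) (Set.range (cycleEdge (m := m))))) :=
  Complex.finrank_real_complex ▸ (regularPolygon hm).isSimplicialBall_simplexJoin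

theorem isSimplicialSphere_simplexBoundaryJoin_cycle (d : ℕ) (hm : 3 ≤ m) :
    IsSimplicialSphere (d + 1)
      (closure (simplexBoundaryJoinFacets (Fin (d + 1)) (Set.range (cycleEdge (m := m))))) :=
  (regularPolygon hm).isSimplicialSphere_simplexBoundaryJoin Complex.finrank_real_complex

end Polygons

/-! ### The gluing moves on face posets -/

section FacePosets

variable {V W : Type}

theorem mem_faces_of_subset {K : PreAbstractSimplicialComplex V} {s t : Finset V}
    (ht : t ∈ K.faces) (hst : s ⊆ t) (hs : s.Nonempty) : s ∈ K.faces :=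
  (K.isRelLowerSet_faces ht).2 hst hs

theorem coe_subset_vertices {K : PreAbstractSimplicialComplex V} {s : Finset V} (hs : s ∈ K.faces) :
    ↑s ⊆ {v | {v} ∈ K.faces} :=
  fun v hv => mem_faces_of_subset hs (singleton_subset_iff.mpr hv) (singleton_nonempty v)

/-- The cells below the cell `s`, as sets of vertices. -/
def vertexSetIic {K : PreAbstractSimplicialComplex V} (s : K.faces) :
    Set.Iic s ↪o Finset V :=
  (OrderEmbedding.subtype _).trans (OrderEmbedding.subtype _)

theorem range_vertexSetIic {K : PreAbstractSimplicialComplex V} (s : K.faces) :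
    Set.range (vertexSetIic s) = {u | u.Nonempty ∧ u ⊆ s.1} := by
  ext u
  constructor
  · rintro ⟨y, rfl⟩
    exact ⟨(K.isRelLowerSet_faces y.1.2).1, y.2⟩
  · rintro ⟨hu, hus⟩
    exact ⟨⟨⟨u, mem_faces_of_subset s.2 hus hu⟩, hus⟩, rfl⟩

theorem exists_orderIso_image [DecidableEq W] {P Q : Type} [PartialOrder P] [PartialOrder Q]
    {g : V → W} {s : Finset V} (hg : Set.InjOn g s) (a : P ↪o Finset V) (b : Q ↪o Finset W)
    (ha : Set.range a = {u | u.Nonempty ∧ u ⊆ s})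
    (hb : Set.range b = {u | u.Nonempty ∧ u ⊆ s.image g}) :
    ∃ e : P ≃o Q, ∀ p, b (e p) = (a p).image g := by
  have ha' : ∀ p, (a p).Nonempty ∧ a p ⊆ s := Set.range_subset_iff.mp ha.subset
  have hb' : ∀ p, (a p).image g ∈ Set.range b := fun p =>
    hb ▸ ⟨(ha' p).1.image g, image_subset_image (ha' p).2⟩
  choose f hf using hb'
  have hle : ∀ p p', f p ≤ f p' ↔ p ≤ p' := fun p p' => by
    rw [← b.le_iff_le, ← a.le_iff_le, hf, hf, ← coe_subset, coe_image, coe_image,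
      hg.image_subset_image_iff (ha' p).2 (ha' p').2, coe_subset]
  have hsurj : Function.Surjective f := fun q => by
    obtain ⟨hq, hqs⟩ := hb.subset ⟨q, rfl⟩
    obtain ⟨u, hu, huq⟩ := subset_image_iff.mp hqs
    obtain ⟨p, rfl⟩ := ha.superset ⟨image_nonempty.mp (huq ▸ hq), hu⟩
    exact ⟨p, b.injective ((hf p).trans huq)⟩
  exact ⟨RelIso.ofSurjective (OrderEmbedding.ofMapLEIff f hle) hsurj, hf⟩

theorem nonempty_orderIso_simplexPoset {P : Type} [PartialOrder P] (a : P ↪o Finset V)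
    {t : Finset V} {D : ℕ} (ht : #t = D + 1)
    (ha : Set.range a = {u | u.Nonempty ∧ u ⊆ t}) : Nonempty (P ≃o SimplexPoset D) := by
  classical
  let g : Fin (D + 1) → V := Subtype.val ∘ (t.equivFinOfCardEq ht).symm
  have hg : g.Injective := Subtype.val_injective.comp (Equiv.injective _)
  have himage : univ.image g = t := by
    rw [← image_image, image_univ_equiv, univ_eq_attach, attach_image_val]
  obtain ⟨e, -⟩ := exists_orderIso_image hg.injOn
    (OrderEmbedding.subtype fun s : Finset (Fin (D + 1)) => s.Nonempty) a (by simp)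
    (himage.symm ▸ ha)
  exact ⟨e.symm⟩

theorem covBy_of_card {K : PreAbstractSimplicialComplex V} {s t : K.faces} (hst : s.1 ⊆ t.1)
    (hcard : #s.1 + 1 = #t.1) : s ⋖ t := by
  refine ⟨lt_of_le_of_ne hst fun h => by simp [h] at hcard, fun c hsc hct => ?_⟩
  have hs : #s.1 < #c.1 := card_lt_card hsc
  have ht : #c.1 < #t.1 := card_lt_card hct
  omega

theorem isMax_iff_mem_facets {K : PreAbstractSimplicialComplex V} {s : K.faces} :
    IsMax s ↔ s.1 ∈ facets K :=
  ⟨fun h => ⟨s.2, fun t ht hst => h (b := ⟨t, ht⟩) hst⟩, fun h t hst => h.2 t.2 hst⟩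

theorem isBoundaryRidge_closure {F : Set (Finset V)} {D : ℕ} (hF : F.Sized (D + 1))
    {s : (closure F).faces} (hs : #s.1 = D) {t : Finset V} (ht : t ∈ F) (hst : s.1 ⊆ t)
    (huniq : ∀ t' ∈ F, s.1 ⊆ t' → t' = t) : IsBoundaryRidge s := by
  have hfacets := facets_closure_of_sized hF D.succ_ne_zero
  have htf : t ∈ facets (closure F) := hfacets.symm ▸ ht
  refine ⟨⟨t, htf.1⟩, isMax_iff_mem_facets.mpr htf, covBy_of_card hst ?_, fun m hm hsm => ?_⟩
  · rw [hs, hF ht]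
  · rw [isMax_iff_mem_facets, hfacets] at hm
    exact Subtype.ext (huniq _ hm hsm)

theorem locallyConstructed_closure_singleton {t : Finset V} {D : ℕ} (ht : #t = D + 1) :
    LocallyConstructed D (closure {t}).faces := by
  obtain ⟨e⟩ := nonempty_orderIso_simplexPoset (OrderEmbedding.subtype (· ∈ (closure {t}).faces))
    ht (Subtype.range_val.trans (by simp [closure]))
  exact .simplex _ e

theorem gluesNewSimplex_closure_insert {F : Set (Finset V)} {t : Finset V} {D : ℕ}
    (ht : #t = D + 1) {σ : (closure F).faces} (hσ : IsBoundaryRidge σ) (hσt : σ.1 ⊆ t)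
    (hinter : ∀ s ∈ F, ∀ v ∈ s, v ∈ t → v ∈ σ.1) :
    GluesNewSimplex D (closure F).faces (closure (insert t F)).faces := by
  have hsub : (closure F).faces ⊆ (closure (insert t F)).faces := by
    rintro s ⟨hs, u, hu, hsu⟩
    exact ⟨hs, u, Or.inr hu, hsu⟩
  have hne : ∀ s ∈ (closure (insert t F)).faces, s.Nonempty := fun s hs => hs.1
  let m : (closure (insert t F)).faces :=
    ⟨t, ((closure F).isRelLowerSet_faces σ.2).1.mono hσt, t, Or.inl rfl, Subset.rfl⟩
  refine ⟨OrderEmbedding.ofMapLEIff (Set.inclusion hsub) fun _ _ => Iff.rfl, σ, m, hσ,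
    nonempty_orderIso_simplexPoset (vertexSetIic m) ht (range_vertexSetIic m), ?_, ?_, ?_⟩
  · rintro _ u hus ⟨s, rfl⟩
    exact ⟨⟨u.1, mem_faces_of_subset s.2 hus (hne _ u.2)⟩, rfl⟩
  · rw [Set.eq_univ_iff_forall]
    rintro ⟨s, hs, u, rfl | hu, hsu⟩
    · exact Or.inr hsu
    · exact Or.inl ⟨⟨s, hs, u, hu, hsu⟩, rfl⟩
  · ext u
    constructor
    · rintro ⟨⟨⟨s, _, u, hu, hsu⟩, rfl⟩, hst⟩
      exact fun v hv => hinter u hu v (hsu hv) (hst hv)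
    · intro hu
      exact ⟨⟨⟨u.1, mem_faces_of_subset σ.2 hu (hne _ u.2)⟩, rfl⟩, Subset.trans hu hσt⟩

end FacePosets

section BoundaryPair

variable {V W : Type} {g : V → W} {a b : V}

theorem injOn_of_injOn_sdiff {S : Set V} (hinj : Set.InjOn g (S \ {b})) (hab : a ≠ b)
    (haS : a ∈ S) (hgab : g a = g b) {s : Finset V} (hs : ↑s ⊆ S) (hsab : a ∈ s → b ∉ s) :
    Set.InjOn g s := by
  have eq_left : ∀ x ∈ s, x ≠ b → g x = g b → x = a := fun x hx hxb h =>
    hinj ⟨hs hx, hxb⟩ ⟨haS, hab⟩ (h.trans hgab.symm)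
  intro x hx y hy hxy
  by_cases hxb : x = b <;> by_cases hyb : y = b
  · rw [hxb, hyb]
  · exact absurd (hxb ▸ hx) (hsab (eq_left y hy hyb (hxb ▸ hxy.symm) ▸ hy))
  · exact absurd (hyb ▸ hy) (hsab (eq_left x hx hxb (hyb ▸ hxy) ▸ hx))
  · exact hinj ⟨hs hx, hxb⟩ ⟨hs hy, hyb⟩ hxy

variable [DecidableEq V]

theorem image_update_id_eq_of_image_eq [DecidableEq W] {S : Set V}
    (hinj : Set.InjOn g (S \ {b})) (hab : a ≠ b) (haS : a ∈ S) (hgab : g a = g b)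
    {s t : Finset V} (hs : ↑s ⊆ S) (ht : ↑t ⊆ S) (h : s.image g = t.image g) :
    s.image (Function.update id b a) = t.image (Function.update id b a) := by
  let π := Function.update id b a
  have hgπ : g ∘ π = g := by
    simp [π, Function.comp_update, hgab]
  have hπ : ∀ u : Finset V, ↑u ⊆ S → ↑(u.image π) ⊆ S \ {b} := fun u hu => by
    rw [coe_image, Set.image_subset_iff]
    intro x hx
    rcases eq_or_ne x b with rfl | hxb
    · simp [π, haS, hab]
    · simp [π, hxb, hu hx]
  rw [← hgπ, ← image_image, ← image_image] at h
  refine coe_injective ((hinj.image_eq_image_iff (hπ s hs) (hπ t ht)).mp ?_)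
  rw [← coe_image, ← coe_image, h]

theorem image_update_id (s : Finset V) (hb : b ∈ s) :
    s.image (Function.update id b a) = insert a (s.erase b) := by
  conv_lhs => rw [← insert_erase hb]
  rw [image_insert, Function.update_self]
  congr 1
  refine (image_congr fun x hx => ?_).trans image_id
  exact Function.update_of_ne (ne_of_mem_erase hx) _ _

theorem image_update_id_of_notMem (s : Finset V) (hb : b ∉ s) :
    s.image (Function.update id b a) = s := by
  refine (image_congr fun x hx => ?_).trans image_id
  exact Function.update_of_ne (ne_of_mem_of_not_mem hx hb) _ _

theorem eq_or_exists_insert_of_image_eq_image [DecidableEq W] {S : Set V}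
    (hinj : Set.InjOn g (S \ {b})) (hab : a ≠ b) (haS : a ∈ S) (hgab : g a = g b)
    {s t : Finset V} (hs : ↑s ⊆ S) (ht : ↑t ⊆ S) (hsab : a ∈ s → b ∉ s) (htab : a ∈ t → b ∉ t)
    (h : s.image g = t.image g) :
    s = t ∨ ∃ u, a ∉ u ∧ b ∉ u ∧
      (s = insert a u ∧ t = insert b u ∨ s = insert b u ∧ t = insert a u) := by
  have h := image_update_id_eq_of_image_eq hinj hab haS hgab hs ht h
  by_cases hbs : b ∈ s <;> by_cases hbt : b ∈ t
  · rw [image_update_id s hbs, image_update_id t hbt] at h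
    have has : a ∉ s.erase b := fun ha => hsab (mem_of_mem_erase ha) hbs
    have hat : a ∉ t.erase b := fun ha => htab (mem_of_mem_erase ha) hbt
    have herase : s.erase b = t.erase b := by rw [← erase_insert has, h, erase_insert hat]
    exact Or.inl (by rw [← insert_erase hbs, herase, insert_erase hbt])
  · rw [image_update_id s hbs, image_update_id_of_notMem t hbt] at h
    exact Or.inr ⟨s.erase b, fun ha => hsab (mem_of_mem_erase ha) hbs, notMem_erase b s,
      Or.inr ⟨(insert_erase hbs).symm, h.symm⟩⟩
  · rw [image_update_id_of_notMem s hbs, image_update_id t hbt] at h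
    exact Or.inr ⟨t.erase b, fun ha => htab (mem_of_mem_erase ha) hbt, notMem_erase b t,
      Or.inl ⟨h, (insert_erase hbt).symm⟩⟩
  · rw [image_update_id_of_notMem s hbs, image_update_id_of_notMem t hbt] at h
    exact Or.inl h

theorem image_swap_eq_self {u : Finset V} (ha : a ∉ u) (hb : b ∉ u) :
    u.image (Equiv.swap a b) = u :=
  (image_congr fun _ hx => Equiv.swap_apply_of_ne_of_ne (ne_of_mem_of_not_mem hx ha)
    (ne_of_mem_of_not_mem hx hb)).trans image_id

theorem image_swap_insert {u : Finset V} (ha : a ∉ u) (hb : b ∉ u) :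
    (insert a u).image (Equiv.swap a b) = insert b u := by
  rw [image_insert, Equiv.swap_apply_left, image_swap_eq_self ha hb]

/-- The map `g` folds `K` along `r`: it identifies the vertex `b` with the vertex `a` and no other
vertices, and the links of `a` and `b` meet only in faces of `r`. -/
structure IsFold (K : PreAbstractSimplicialComplex V) (g : V → W) (a b : V) (r : Finset V) :
    Prop where
  ne : a ≠ b
  left_notMem : a ∉ r
  right_notMem : b ∉ r
  insert_left_mem : insert a r ∈ K.faces
  insert_right_mem : insert b r ∈ K.faces
  map_eq : g a = g b
  injOn : Set.InjOn g ({v | {v} ∈ K.faces} \ {b})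
  subset_of_insert_mem {u : Finset V} :
    insert a u ∈ K.faces → insert b u ∈ K.faces → u ⊆ r

namespace IsFold

variable {K : PreAbstractSimplicialComplex V} {r : Finset V}

theorem notMem_of_mem (h : IsFold K g a b r) {s : Finset V} (hs : s ∈ K.faces) (ha : a ∈ s) :
    b ∉ s := fun hb =>
  h.left_notMem <| singleton_subset_iff.mp <| h.subset_of_insert_mem
    (mem_faces_of_subset hs (by simpa using ha) (by simp))
    (mem_faces_of_subset hs (by simp [insert_subset_iff, ha, hb]) (by simp))

theorem left_mem_vertices (h : IsFold K g a b r) : a ∈ {v | {v} ∈ K.faces} :=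
  coe_subset_vertices h.insert_left_mem (mem_insert_self a r)

theorem injOn_face (h : IsFold K g a b r) {s : Finset V} (hs : s ∈ K.faces) : Set.InjOn g s :=
  injOn_of_injOn_sdiff h.injOn h.ne h.left_mem_vertices h.map_eq (coe_subset_vertices hs)
    (h.notMem_of_mem hs)

theorem comp_swap (h : IsFold K g a b r) : g ∘ Equiv.swap a b = g := by
  funext x
  rcases eq_or_ne x a with rfl | hxa
  · simp [h.map_eq]
  rcases eq_or_ne x b with rfl | hxb
  · simp [h.map_eq]
  · simp [Equiv.swap_apply_of_ne_of_ne hxa hxb]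

theorem comp {X : Type} (h : IsFold K g a b r) {f : W → X} (hf : f.Injective) :
    IsFold K (f ∘ g) a b r :=
  { h with
    map_eq := congrArg f h.map_eq
    injOn := hf.comp_injOn h.injOn }

variable [DecidableEq W]

theorem image_eq_image_iff (h : IsFold K g a b r) {s t : Finset V} (hs : s ∈ K.faces)
    (ht : t ∈ K.faces) :
    s.image g = t.image g ↔ s = t ∨
      (s ⊆ insert a r ∧ s.image (Equiv.swap a b) = t) ∨
        (t ⊆ insert a r ∧ t.image (Equiv.swap a b) = s) := by
  constructor
  · intro hst
    rcases eq_or_exists_insert_of_image_eq_image h.injOn h.ne h.left_mem_vertices h.map_eq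
      (coe_subset_vertices hs) (coe_subset_vertices ht) (h.notMem_of_mem hs) (h.notMem_of_mem ht)
      hst with rfl | ⟨u, hau, hbu, ⟨rfl, rfl⟩ | ⟨rfl, rfl⟩⟩
    · exact Or.inl rfl
    · exact Or.inr (Or.inl ⟨insert_subset_insert a (h.subset_of_insert_mem hs ht),
        image_swap_insert hau hbu⟩)
    · exact Or.inr (Or.inr ⟨insert_subset_insert a (h.subset_of_insert_mem ht hs),
        image_swap_insert hau hbu⟩)
  · rintro (rfl | ⟨-, rfl⟩ | ⟨-, rfl⟩)
    · rfl
    · rw [image_image, h.comp_swap]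
    · rw [image_image, h.comp_swap]

theorem gluesBoundaryPair (h : IsFold K g a b r) (hr : r.Nonempty)
    (ha : IsBoundaryRidge (⟨_, h.insert_left_mem⟩ : K.faces))
    (hb : IsBoundaryRidge (⟨_, h.insert_right_mem⟩ : K.faces)) :
    GluesBoundaryPair K.faces (K.map g).faces := by
  let σ : K.faces := ⟨_, h.insert_left_mem⟩
  let τ : K.faces := ⟨_, h.insert_right_mem⟩
  let ρ : K.faces := ⟨r, mem_faces_of_subset σ.2 (subset_insert a r) hr⟩
  let q : K.faces → (K.map g).faces := fun s => ⟨s.1.image g, s.1, s.2, rfl⟩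
  obtain ⟨φ, hφ⟩ := exists_orderIso_image (Equiv.swap a b).injective.injOn (vertexSetIic σ)
    (vertexSetIic τ) (range_vertexSetIic σ)
    (by rw [image_swap_insert h.left_notMem h.right_notMem, range_vertexSetIic])
  change ∀ x, (φ x).1.1 = x.1.1.image (Equiv.swap a b) at hφ
  have exists_iff : ∀ s t : K.faces, (∃ z : Set.Iic σ, (z : K.faces) = s ∧ (φ z : K.faces) = t) ↔
      s.1 ⊆ insert a r ∧ s.1.image (Equiv.swap a b) = t.1 := fun s t =>
    ⟨by rintro ⟨z, rfl, rfl⟩; exact ⟨z.2, (hφ z).symm⟩,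
      fun ⟨hs, hst⟩ => ⟨⟨s, hs⟩, rfl, Subtype.ext ((hφ _).trans hst)⟩⟩
  refine ⟨σ, τ, ρ, φ, q, fun hστ => ?_, ha, hb,
    covBy_of_card (subset_insert a r) (card_insert_of_notMem h.left_notMem).symm,
    covBy_of_card (subset_insert b r) (card_insert_of_notMem h.right_notMem).symm,
    fun x hx => ?_, ?_, fun s t => ?_, fun s => ?_⟩
  · exact h.notMem_of_mem σ.2 (mem_insert_self a r)
      (congrArg Subtype.val hστ ▸ mem_insert_self b r)
  · exact Subtype.ext <| (hφ x).trans <|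
      image_swap_eq_self (fun hax => h.left_notMem (hx hax)) fun hbx => h.right_notMem (hx hbx)
  · rintro ⟨_, s, hs, rfl⟩
    exact ⟨⟨s, hs⟩, rfl⟩
  · rw [exists_iff, exists_iff, Subtype.ext_iff, Subtype.ext_iff]
    exact h.image_eq_image_iff s.2 t.2
  · obtain ⟨e, he⟩ := exists_orderIso_image (h.injOn_face s.2) (vertexSetIic s)
      (vertexSetIic (q s)) (range_vertexSetIic s) (range_vertexSetIic (q s))
    exact ⟨e, fun y => Subtype.ext (he y)⟩

end IsFold

end BoundaryPair

/-! ### Local constructibility of the join of a simplex and a cycle -/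

section Paths

variable {ι : Type} [Fintype ι]

/-- The edges of the path `0, 1, …, m`. -/
def pathEdges (m : ℕ) : Set (Finset ℕ) := (fun j => {j, j + 1}) '' Set.Iio m

theorem pathEdges_one : pathEdges 1 = {{0, 1}} := by
  simp [pathEdges]

theorem pathEdges_succ (m : ℕ) : pathEdges (m + 1) = insert {m, m + 1} (pathEdges m) := by
  have hIio : Set.Iio (m + 1) = insert m (Set.Iio m) := Order.Iio_succ_eq_insert m
  rw [pathEdges, hIio, Set.image_insert_eq, pathEdges]

theorem sized_pathEdges (m : ℕ) : (pathEdges m).Sized 2 := by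
  rintro _ ⟨j, -, rfl⟩
  exact card_pair (by omega)

theorem isBoundaryRidge_simplexJoin {I : Type} {F : Set (Finset I)} {k : ℕ}
    (hF : F.Sized (k + 1)) {t e : Finset I} (ht : #t = k) (he : e ∈ F) (hte : t ⊆ e)
    (huniq : ∀ e' ∈ F, t ⊆ e' → e' = e) {s : (closure (simplexJoinFacets ι F)).faces}
    (hs : s.1 = univ.disjSum t) : IsBoundaryRidge s := by
  refine isBoundaryRidge_closure (D := Fintype.card ι + k) (sized_simplexJoinFacets hF)
    (by rw [hs, card_disjSum, card_univ, ht]) ⟨e, he, rfl⟩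
    (hs ▸ disjSum_mono_right _ hte) ?_
  rintro _ ⟨e', he', rfl⟩ hse'
  rw [hs, subset_disjSum, toRight_disjSum] at hse'
  rw [huniq e' he' hse'.2]

theorem isBoundaryRidge_simplexJoin_path {m l j : ℕ} (hj : j < m) (hl : l = j ∨ l = j + 1)
    (huniq : ∀ j' < m, l = j' ∨ l = j' + 1 → j' = j)
    {s : (closure (simplexJoinFacets ι (pathEdges m))).faces} (hs : s.1 = univ.disjSum {l}) :
    IsBoundaryRidge s := by
  refine isBoundaryRidge_simplexJoin (sized_pathEdges m) (card_singleton l) ⟨j, hj, rfl⟩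
    (by simpa using hl) ?_ hs
  rintro _ ⟨j', hj', rfl⟩ hl'
  rw [huniq j' hj' (by simpa using hl')]

theorem gluesNewSimplex_simplexJoin_path (m : ℕ) :
    GluesNewSimplex (Fintype.card ι + 1) (closure (simplexJoinFacets ι (pathEdges (m + 1)))).faces
      (closure (simplexJoinFacets ι (pathEdges (m + 2)))).faces := by
  have hridge : univ.disjSum {m + 1} ∈ (closure (simplexJoinFacets ι (pathEdges (m + 1)))).faces :=
    ⟨⟨.inr (m + 1), by simp⟩, _, ⟨{m, m + 1}, ⟨m, by simp, rfl⟩, rfl⟩,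
      disjSum_mono_right _ (by simp)⟩
  rw [pathEdges_succ (m + 1), simplexJoinFacets, simplexJoinFacets, Set.image_insert_eq]
  refine gluesNewSimplex_closure_insert (σ := ⟨_, hridge⟩) (by simp)
    (isBoundaryRidge_simplexJoin_path (j := m) (by omega) (by omega) (by omega) rfl)
    (disjSum_mono_right _ (by simp)) ?_
  rintro _ ⟨_, ⟨j, hj, rfl⟩, rfl⟩ (i | l) hl hl'
  · simp
  · rw [Set.mem_Iio] at hj
    simp only [inr_mem_disjSum, mem_insert, mem_singleton] at hl hl' ⊢
    omega

theorem locallyConstructed_simplexJoin_path (m : ℕ) :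
    LocallyConstructed (Fintype.card ι + 1)
      (closure (simplexJoinFacets ι (pathEdges (m + 1)))).faces := by
  induction m with
  | zero =>
    rw [zero_add, pathEdges_one, simplexJoinFacets, Set.image_singleton]
    exact locallyConstructed_closure_singleton (by simp)
  | succ m ih => exact .glueNew _ _ ih (gluesNewSimplex_simplexJoin_path m)

end Paths

section ClosingThePath

variable {ι V : Type} [Fintype ι] {m : ℕ}

theorem insert_inr_disjSum_empty {I : Type} [DecidableEq ι] [DecidableEq I] (v : I) :
    insert (.inr v) (univ.disjSum ∅ : Finset (ι ⊕ I)) = univ.disjSum {v} := by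
  ext (i | w) <;> simp

theorem mem_simplexJoin_path_faces_iff {s : Finset (ι ⊕ ℕ)} :
    s ∈ (closure (simplexJoinFacets ι (pathEdges m))).faces ↔
      s.Nonempty ∧ ∃ j < m, ∀ l, .inr l ∈ s → l = j ∨ l = j + 1 := by
  simp [closure, simplexJoinFacets, pathEdges, subset_iff]

theorem isFold_simplexJoin_path [DecidableEq ι] (hm : 3 ≤ m) :
    IsFold (closure (simplexJoinFacets ι (pathEdges m)))
      (Sum.map id ((↑) : ℕ → ZMod m)) (.inr 0) (.inr m) (univ.disjSum ∅) where
  ne := Sum.inr_injective.ne (by omega)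
  left_notMem := by simp
  right_notMem := by simp
  insert_left_mem := mem_simplexJoin_path_faces_iff.mpr
    ⟨insert_nonempty _ _, 0, by omega, by simp +contextual⟩
  insert_right_mem := mem_simplexJoin_path_faces_iff.mpr
    ⟨insert_nonempty _ _, m - 1, by omega, by simp; omega⟩
  map_eq := by simp
  injOn := by
    have lt_of_mem : ∀ l, (.inr l : ι ⊕ ℕ) ∈
        {v | {v} ∈ (closure (simplexJoinFacets ι (pathEdges m))).faces} \ {.inr m} → l < m := by
      rintro l ⟨hl, hne⟩
      obtain ⟨-, j, hj, hlj⟩ := mem_simplexJoin_path_faces_iff.mp hl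
      have hlm : l ≠ m := fun h => hne (congrArg _ h)
      have := hlj l (mem_singleton_self _)
      omega
    rintro (i | l) hl (i' | l') hl' h
    · exact congrArg _ (Sum.inl_injective h)
    · cases h
    · cases h
    · exact congrArg _ (CharP.natCast_injOn_Iio (ZMod m) m (lt_of_mem l hl) (lt_of_mem l' hl')
        (Sum.inr_injective h))
  subset_of_insert_mem := by
    intro u hu_left hu_right
    obtain ⟨-, j, hj, h_left⟩ := mem_simplexJoin_path_faces_iff.mp hu_left
    obtain ⟨-, k, hk, h_right⟩ := mem_simplexJoin_path_faces_iff.mp hu_right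
    rintro (i | l) hl
    · simp
    · have := h_left 0 (mem_insert_self _ _)
      have := h_right m (mem_insert_self _ _)
      have := h_left l (mem_insert_of_mem hl)
      have := h_right l (mem_insert_of_mem hl)
      omega

theorem image_map_disjSum {I J : Type} [DecidableEq ι] [DecidableEq J] (f : I → J)
    (e : Finset I) :
    (univ.disjSum e : Finset (ι ⊕ I)).image (Sum.map id f) = univ.disjSum (e.image f) := by
  ext (i | j) <;> simp

theorem image_image_pathEdges [NeZero m] :
    image ((↑) : ℕ → ZMod m) '' pathEdges m = Set.range cycleEdge := by
  rw [pathEdges, Set.image_image]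
  ext e
  constructor
  · rintro ⟨j, -, rfl⟩
    exact ⟨j, by simp [cycleEdge]⟩
  · rintro ⟨j, rfl⟩
    exact ⟨j.val, j.val_lt, by simp [cycleEdge]⟩

theorem map_simplexJoin_path [DecidableEq ι] [NeZero m] :
    (closure (simplexJoinFacets ι (pathEdges m))).map (Sum.map id ((↑) : ℕ → ZMod m)) =
      closure (simplexJoinFacets ι (Set.range cycleEdge)) := by
  rw [map_closure, simplexJoinFacets, simplexJoinFacets, ← image_image_pathEdges,
    Set.image_image, Set.image_image]
  simp only [image_map_disjSum]

theorem locallyConstructed_map_simplexJoin_cycle [Nonempty ι] [DecidableEq V] (hm : 3 ≤ m)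
    {f : ι ⊕ ZMod m → V} (hf : f.Injective) :
    LocallyConstructed (Fintype.card ι + 1)
      ((closure (simplexJoinFacets ι (Set.range cycleEdge))).map f).faces := by
  classical
  have : NeZero m := ⟨by omega⟩
  obtain ⟨k, rfl⟩ := Nat.exists_eq_add_of_le' (show 1 ≤ m by omega)
  have hfold := (isFold_simplexJoin_path (ι := ι) hm).comp hf
  rw [← map_simplexJoin_path, map_map]
  refine .gluePair _ _ (locallyConstructed_simplexJoin_path k)
    (hfold.gluesBoundaryPair (by simp) ?_ ?_)
  · exact isBoundaryRidge_simplexJoin_path (j := 0) (by omega) (by omega) (by omega)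
      (insert_inr_disjSum_empty 0)
  · exact isBoundaryRidge_simplexJoin_path (j := k) (by omega) (by omega) (by omega)
      (insert_inr_disjSum_empty (k + 1))

theorem boundary_simplexJoin_cycle [DecidableEq ι] [Nonempty ι] (hm : 3 ≤ m) :
    boundary (closure (simplexJoinFacets ι (Set.range (cycleEdge (m := m))))) =
      closure (simplexBoundaryJoinFacets ι (Set.range cycleEdge)) := by
  refine boundary_closure_simplexJoinFacets (sized_range_cycleEdge hm) ?_
  rintro _ ⟨j, rfl⟩ t ht
  obtain ⟨l, hne, hl⟩ := exists_ne_cycleEdge_of_ssubset hm ht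
  exact ⟨_, ⟨l, rfl⟩, hne, hl⟩

theorem isLCSphere_simplexBoundaryJoin_cycle [Fintype V] [DecidableEq V] {d : ℕ} (hd : 1 ≤ d)
    (hm : 3 ≤ m) (E : Fin d ⊕ ZMod m ≃ V) :
    IsLCSphere d
      ((closure (simplexBoundaryJoinFacets (Fin d) (Set.range cycleEdge))).map E) := by
  have : NeZero m := ⟨by omega⟩
  obtain ⟨d, rfl⟩ := Nat.exists_eq_add_of_le' hd
  let E' := E.trans (Fintype.equivFin V)
  refine ⟨(isSimplicialSphere_simplexBoundaryJoin_cycle d hm).map E, Fintype.card V,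
    (Fintype.equivFin V).toEmbedding, _,
    ⟨(isSimplicialBall_simplexJoin_cycle d hm).map E', ?_⟩, ?_⟩
  · simpa using locallyConstructed_map_simplexJoin_cycle hm E'.injective
  · rw [boundary_map _ E'.injective, boundary_simplexJoin_cycle hm, map_map]
    rfl

end ClosingThePath

/-! ### Cycles on the vertices that are not poles -/

section CyclicOrders

variable {n d : ℕ} {C : SimpleGraph (NonPole n d)} {c : ZMod (n - d) ≃ NonPole n d}

/-- The bijection `c` lists the vertices of the cycle `C` in cyclic order. -/
def IsCyclicOrder (C : SimpleGraph (NonPole n d)) (c : ZMod (n - d) ≃ NonPole n d) : Prop :=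
  ∀ i j, C.Adj (c i) (c j) ↔ j = i + 1 ∨ i = j + 1

theorem cycleGraph_adj_iff_finEquiv {m : ℕ} [NeZero m] (hm : 2 ≤ m) (u v : Fin m) :
    (SimpleGraph.cycleGraph m).Adj u v ↔
      ZMod.finEquiv m v = ZMod.finEquiv m u + 1 ∨ ZMod.finEquiv m u = ZMod.finEquiv m v + 1 := by
  obtain ⟨k, rfl⟩ := Nat.exists_eq_add_of_le' hm
  rw [SimpleGraph.cycleGraph_adj, sub_eq_iff_eq_add', sub_eq_iff_eq_add', or_comm,
    ← map_one (ZMod.finEquiv (k + 2)), ← map_add, ← map_add, EmbeddingLike.apply_eq_iff_eq,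
    EmbeddingLike.apply_eq_iff_eq]

theorem isHamiltonCycle_iff_exists_isCyclicOrder (hm : 3 ≤ n - d) :
    IsHamiltonCycle C ↔ ∃ c, IsCyclicOrder C c := by
  have : NeZero (n - d) := ⟨by omega⟩
  constructor
  · rintro ⟨-, ⟨g⟩⟩
    let E := g.toEquiv.trans (ZMod.finEquiv (n - d)).toEquiv
    refine ⟨E.symm, fun i j => ?_⟩
    obtain ⟨x, rfl⟩ := E.surjective i
    obtain ⟨y, rfl⟩ := E.surjective j
    rw [E.symm_apply_apply, E.symm_apply_apply, ← g.map_adj_iff]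
    exact cycleGraph_adj_iff_finEquiv (by omega) _ _
  · rintro ⟨c, hc⟩
    refine ⟨hm, ⟨SimpleGraph.Iso.symm ⟨(ZMod.finEquiv (n - d)).toEquiv.trans c, ?_⟩⟩⟩
    exact (hc _ _).trans (cycleGraph_adj_iff_finEquiv (by omega) _ _).symm

/-- The vertices of `B(C)` split into the poles and the vertices of the cycle, the latter listed
by `c`. -/
def vertexEquiv (h : d ≤ n) (c : ZMod (n - d) ≃ NonPole n d) : Fin d ⊕ ZMod (n - d) ≃ Fin n :=
  ((Fin.castLEquiv h).sumCongr (c.trans (Equiv.subtypeEquivRight fun _ => not_lt.symm))).trans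
    (Equiv.sumCompl _)

@[simp]
theorem vertexEquiv_inl (h : d ≤ n) (c : ZMod (n - d) ≃ NonPole n d) (i : Fin d) :
    vertexEquiv h c (.inl i) = i.castLE h := rfl

@[simp]
theorem vertexEquiv_inr (h : d ≤ n) (c : ZMod (n - d) ≃ NonPole n d) (j : ZMod (n - d)) :
    vertexEquiv h c (.inr j) = (c j).1 := rfl

theorem mem_poles_iff {v : Fin n} : v ∈ poles n d ↔ (v : ℕ) < d := by
  simp [poles]

theorem exists_mem_poles_iff (h : d ≤ n) {p : Fin n → Prop} :
    (∃ v ∈ poles n d, p v) ↔ ∃ i : Fin d, p (i.castLE h) := by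
  simp only [mem_poles_iff]
  exact ⟨fun ⟨v, hv, hp⟩ => ⟨⟨v, hv⟩, hp⟩, fun ⟨i, hp⟩ => ⟨_, i.isLt, hp⟩⟩

theorem fSet_comm (x y : NonPole n d) : fSet x y = fSet y x := by
  rw [fSet, fSet, pair_comm]

theorem fSet_eq_image (h : d ≤ n) (c : ZMod (n - d) ≃ NonPole n d) (j : ZMod (n - d)) :
    fSet (c j) (c (j + 1)) = (univ.disjSum (cycleEdge j)).image (vertexEquiv h c) := by
  ext v
  obtain ⟨i | l, rfl⟩ := (vertexEquiv h c).surjective v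
  · simp [fSet, mem_poles_iff]
  · have hnotMem : (c l).1 ∉ poles n d := mem_poles_iff.not.mpr (not_lt.mpr (c l).2)
    rw [(vertexEquiv h c).injective.mem_finset_image]
    simp [fSet, hnotMem, cycleEdge, Subtype.coe_inj]

theorem IsCyclicOrder.exists_adj_iff (hc : IsCyclicOrder C c) (h : d ≤ n)
    (p : Finset (Fin n) → Prop) :
    (∃ x y, C.Adj x y ∧ p (fSet x y)) ↔
      ∃ j, p ((univ.disjSum (cycleEdge j)).image (vertexEquiv h c)) := by
  simp only [← fSet_eq_image]
  constructor
  · rintro ⟨x, y, hxy, hp⟩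
    obtain ⟨i, rfl⟩ := c.surjective x
    obtain ⟨j, rfl⟩ := c.surjective y
    obtain rfl | rfl := (hc i j).mp hxy
    · exact ⟨i, hp⟩
    · exact ⟨j, fSet_comm _ _ ▸ hp⟩
  · rintro ⟨j, hp⟩
    exact ⟨c j, c (j + 1), (hc _ _).mpr (Or.inl rfl), hp⟩

theorem IsCyclicOrder.ballOf_eq (hc : IsCyclicOrder C c) (h : d ≤ n) :
    ballOf C = (closure (simplexJoinFacets (Fin d) (Set.range cycleEdge))).map
      (vertexEquiv h c) := by
  rw [ballOf, map_closure]
  congr 1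
  ext s
  rw [Set.mem_ofPred_eq, hc.exists_adj_iff h (s = ·)]
  simp [simplexJoinFacets, eq_comm]

theorem IsCyclicOrder.sphereOf_eq (hc : IsCyclicOrder C c) (hd : 1 ≤ d) (hm : 3 ≤ n - d) :
    sphereOf C = (closure (simplexBoundaryJoinFacets (Fin d) (Set.range cycleEdge))).map
      (vertexEquiv (by omega) c) := by
  have : NeZero d := ⟨by omega⟩
  rw [sphereOf, hc.ballOf_eq (by omega), boundary_map _ (Equiv.injective _),
    boundary_simplexJoin_cycle hm]

theorem IsCyclicOrder.facets_sphereOf_eq_image (hc : IsCyclicOrder C c) (hd : 1 ≤ d)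
    (hm : 3 ≤ n - d) :
    facets (sphereOf C) = image (vertexEquiv (by omega) c) ''
      simplexBoundaryJoinFacets (Fin d) (Set.range cycleEdge) := by
  rw [hc.sphereOf_eq hd hm, facets_map _ (Equiv.injective _),
    facets_closure_of_sized (sized_simplexBoundaryJoinFacets (sized_range_cycleEdge hm)) (by simp)]

theorem IsCyclicOrder.ncard_facets_sphereOf (hc : IsCyclicOrder C c) (hd : 1 ≤ d)
    (hm : 3 ≤ n - d) : (facets (sphereOf C)).ncard = d * (n - d) := by
  rw [hc.facets_sphereOf_eq_image hd hm,
    Set.ncard_image_of_injective _ (image_injective (Equiv.injective _)),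
    ncard_simplexBoundaryJoinFacets, Fintype.card_fin, ← Set.image_univ,
    Set.ncard_image_of_injective _ (cycleEdge_injective hm), Set.ncard_univ, Nat.card_zmod]

theorem erase_inl_disjSum {ι I : Type} [DecidableEq ι] [DecidableEq I] (s : Finset ι)
    (t : Finset I) (i : ι) : (s.disjSum t).erase (.inl i) = (s.erase i).disjSum t := by
  ext (i' | j) <;> simp

theorem IsCyclicOrder.facets_sphereOf (hc : IsCyclicOrder C c) (hd : 1 ≤ d) (hm : 3 ≤ n - d) :
    facets (sphereOf C) =
      {s | ∃ x y, C.Adj x y ∧ ∃ v ∈ poles n d, s = (fSet x y).erase v} := by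
  have h : d ≤ n := by omega
  ext s
  rw [hc.facets_sphereOf_eq_image hd hm, Set.mem_ofPred_eq,
    hc.exists_adj_iff h (fun f => ∃ v ∈ poles n d, s = f.erase v)]
  simp only [exists_mem_poles_iff h, ← vertexEquiv_inl h c, ← image_erase (Equiv.injective _),
    erase_inl_disjSum, simplexBoundaryJoinFacets, Set.image_image2]
  rw [exists_comm]
  simp [eq_comm]

theorem IsCyclicOrder.exists_adj (hc : IsCyclicOrder C c) : ∃ x y, C.Adj x y :=
  ⟨c 0, c 1, (hc 0 1).mpr (Or.inl (zero_add 1).symm)⟩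

theorem ballOf_eq_iteratedCone (hC : ∃ x y, C.Adj x y) : ballOf C = iteratedCone C := by
  have hne : {s : Finset (Fin n) | ∃ x y : NonPole n d, C.Adj x y ∧ s = {x.1, y.1}}.Nonempty := by
    obtain ⟨x, y, hxy⟩ := hC
    exact ⟨_, x, y, hxy, rfl⟩
  have hpoles : ((List.finRange n).filter (fun i : Fin n => (i : ℕ) < d)).toFinset =
      poles n d := by
    ext i
    simp [poles]
  rw [iteratedCone, graphComplex, foldr_cone_closure hne, hpoles, ballOf]
  congr 1
  ext s
  constructor
  · rintro ⟨x, y, hxy, rfl⟩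
    exact ⟨_, ⟨x, y, hxy, rfl⟩, rfl⟩
  · rintro ⟨_, ⟨x, y, hxy, rfl⟩, rfl⟩
    exact ⟨x, y, hxy, rfl⟩

end CyclicOrders

section StandardCycle

variable {n d : ℕ}

/-- The vertices of the standard cycle in cyclic order. -/
def standardOrder (n d : ℕ) [NeZero (n - d)] : ZMod (n - d) ≃ NonPole n d where
  toFun j := ⟨⟨d + j.val, by have := j.val_lt; omega⟩, Nat.le_add_right _ _⟩
  invFun x := (x.1 - d : ℕ)
  left_inv j := by simp
  right_inv x := by
    have := x.2
    have hval : ((x.1 - d : ℕ) : ZMod (n - d)).val = x.1 - d := ZMod.val_natCast_of_lt (by omega)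
    ext
    simp only [hval]
    omega

@[simp]
theorem val_standardOrder [NeZero (n - d)] (j : ZMod (n - d)) :
    ((standardOrder n d j).1 : ℕ) = d + j.val := rfl

theorem val_eq_val_add_one_mod_iff {m : ℕ} [NeZero m] (i j : ZMod m) :
    j.val = (i.val + 1) % m ↔ j = i + 1 := by
  rw [← (ZMod.val_injective m).eq_iff, ZMod.val_add, ZMod.val_one_eq_one_mod, Nat.add_mod_mod]

theorem isCyclicOrder_standardOrder [NeZero (n - d)] (hm : 3 ≤ n - d) :
    IsCyclicOrder (standardCycle n d) (standardOrder n d) := by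
  intro i j
  simp only [standardCycle, SimpleGraph.fromRel_adj, val_standardOrder, add_tsub_cancel_left,
    val_eq_val_add_one_mod_iff, ne_eq, EmbeddingLike.apply_eq_iff_eq, and_iff_right_iff_imp]
  rintro (rfl | rfl) <;> simp [one_ne_zero_of_three_le hm]

theorem exists_perm_val_eq_add_mod (n k : ℕ) [NeZero n] :
    ∃ e : Equiv.Perm (Fin n), ∀ i, (e i : ℕ) = (i + k) % n :=
  ⟨Equiv.addRight (Fin.ofNat n k), fun i => by simp [Fin.val_add]⟩

theorem filter_val_lt_image {m k : ℕ} {ι I : Type} {f : ι ⊕ I → Fin m}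
    (hl : ∀ i, k ≤ (f (.inl i) : ℕ)) (hr : ∀ j, (f (.inr j) : ℕ) < k) (u : Finset (ι ⊕ I)) :
    (u.image f).filter (fun v : Fin m => (v : ℕ) < k) = u.toRight.image (f ∘ .inr) := by
  ext v
  simp only [mem_filter, mem_image, mem_toRight, Function.comp_apply]
  constructor
  · rintro ⟨⟨i | j, hu, rfl⟩, hv⟩
    · exact absurd hv (hl i).not_gt
    · exact ⟨j, hu, rfl⟩
  · rintro ⟨j, hu, rfl⟩
    exact ⟨⟨_, hu, rfl⟩, hr j⟩

theorem mem_range_cycleEdge_iff_exists_image_eq {m : ℕ} [NeZero m] {f : ZMod m → Fin n}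
    (hf : ∀ j, (f j : ℕ) = j.val) {e : Finset (ZMod m)} :
    e ∈ Set.range cycleEdge ↔
      ∃ i j : Fin n, (i : ℕ) < m ∧ (j : ℕ) = (i + 1) % m ∧ e.image f = {i, j} := by
  have hinj : f.Injective := fun j l h =>
    ZMod.val_injective m (by rw [← hf, ← hf, h])
  have hsucc : ∀ l, (f (l + 1) : ℕ) = (f l + 1) % m := fun l => by
    rw [hf, hf, val_eq_val_add_one_mod_iff]
  have himage : ∀ l, (cycleEdge l).image f = {f l, f (l + 1)} := fun l => by simp [cycleEdge]
  constructor
  · rintro ⟨l, rfl⟩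
    exact ⟨f l, f (l + 1), hf l ▸ l.val_lt, hsucc l, himage l⟩
  · rintro ⟨i, j, hi, hj, he⟩
    obtain ⟨l, rfl⟩ : ∃ l, f l = i :=
      ⟨(i : ℕ), Fin.ext (by rw [hf, ZMod.val_natCast_of_lt hi])⟩
    obtain rfl : f (l + 1) = j := Fin.ext ((hsucc l).trans hj.symm)
    exact ⟨l, image_injective hinj ((himage l).trans he.symm)⟩

theorem map_simplexBoundaryJoin_cycle_eq_starSphere (hd : 1 ≤ d) (hm : 3 ≤ n - d)
    (E : Fin d ⊕ ZMod (n - d) ≃ Fin n) (hl : ∀ i, n - d ≤ (E (.inl i) : ℕ))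
    (hr : ∀ j, (E (.inr j) : ℕ) = j.val) :
    (closure (simplexBoundaryJoinFacets (Fin d) (Set.range cycleEdge))).map E =
      starSphere n d := by
  have : NeZero d := ⟨by omega⟩
  have : NeZero (n - d) := ⟨by omega⟩
  have hlt : ∀ j, (E (.inr j) : ℕ) < n - d := fun j => hr j ▸ j.val_lt
  rw [map_closure, starSphere]
  congr 1
  ext s
  obtain ⟨u, rfl⟩ : ∃ u, u.image E = s := ⟨s.image E.symm, by simp [image_image]⟩
  rw [(image_injective E.injective).mem_set_image, Set.mem_ofPred_eq,
    mem_simplexBoundaryJoinFacets_iff_card (sized_range_cycleEdge hm),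
    mem_range_cycleEdge_iff_exists_image_eq (f := E ∘ .inr) hr,
    card_image_of_injective _ E.injective, filter_val_lt_image hl hlt, Fintype.card_fin]
  exact and_congr_left' (by omega)

end StandardCycle

end LCSphere

theorem proposition5p1 (n d : ℕ) (hd : 1 ≤ d) (hn : d + 3 ≤ n) :
    (∀ C : SimpleGraph (LCSphere.NonPole n d), LCSphere.IsHamiltonCycle C →
      LCSphere.ballOf C = LCSphere.iteratedCone C ∧
      LCSphere.IsLCSphere d (LCSphere.sphereOf C) ∧
      LCSphere.facets (LCSphere.sphereOf C) =
        {s | ∃ x y : LCSphere.NonPole n d, C.Adj x y ∧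
          ∃ v ∈ LCSphere.poles n d, s = (LCSphere.fSet x y).erase v} ∧
      (LCSphere.facets (LCSphere.sphereOf C)).ncard = d * (n - d)) ∧
    LCSphere.IsHamiltonCycle (LCSphere.standardCycle n d) ∧
    (∃ e : Equiv.Perm (Fin n), (∀ i : Fin n, (e i : ℕ) = ((i : ℕ) + (n - d)) % n) ∧
      (LCSphere.sphereOf (LCSphere.standardCycle n d)).map e = LCSphere.starSphere n d) ∧
    LCSphere.IsLCSphere d (LCSphere.starSphere n d) := by
  have hm : 3 ≤ n - d := by omega
  have : NeZero n := ⟨by omega⟩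
  have : NeZero (n - d) := ⟨by omega⟩
  have hstd := LCSphere.isCyclicOrder_standardOrder hm
  obtain ⟨e, he⟩ := LCSphere.exists_perm_val_eq_add_mod n (n - d)
  have hstar := LCSphere.map_simplexBoundaryJoin_cycle_eq_starSphere hd hm
    ((LCSphere.vertexEquiv (by omega) (LCSphere.standardOrder n d)).trans e)
    (fun i => by simp [he, Nat.mod_eq_of_lt (show i + (n - d) < n by omega)])
    (fun j => by simp [he, add_right_comm d, show d + (n - d) = n by omega,
      Nat.mod_eq_of_lt (j.val_lt.trans_le (Nat.sub_le n d))])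
  refine ⟨fun C hC => ?_,
    (LCSphere.isHamiltonCycle_iff_exists_isCyclicOrder hm).mpr ⟨_, hstd⟩, ⟨e, he, ?_⟩, ?_⟩
  · obtain ⟨c, hc⟩ := (LCSphere.isHamiltonCycle_iff_exists_isCyclicOrder hm).mp hC
    refine ⟨LCSphere.ballOf_eq_iteratedCone hc.exists_adj, ?_, hc.facets_sphereOf hd hm,
      hc.ncard_facets_sphereOf hd hm⟩
    rw [hc.sphereOf_eq hd hm]
    exact LCSphere.isLCSphere_simplexBoundaryJoin_cycle hd hm _
  · rw [hstd.sphereOf_eq hd hm, LCSphere.map_map, ← hstar]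
    rfl
  · rw [← hstar]
    exact LCSphere.isLCSphere_simplexBoundaryJoin_cycle hd hm _
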